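/- Let $N\in\{2,3\}$, let $\Omega\subset\mathbb R^N$ be a bounded polygonal (polyhedral) domain with Lipschitz boundary, $T>0$, and let $\mu>0$, $N\lambda+2\mu\ge 0$, $\mu+\lambda>0$, $a>0$, $\gamma>1$, $\epsilon\in(0,1)$ and $\mathbf f\in L^2((0,T)\times\Omega)^N$; put $p(\varrho)=a\varrho^\gamma$. Let $E_h$ be a conforming triangular ($N=2$) or tetrahedral ($N=3$) mesh of $\Omega$ with maximal element diameter $h>0$, $\Gamma_h$ its set of faces (edges if $N=2$), and $\Gamma_h^I=\{\Gamma\in\Gamma_h:\Gamma\not\subset\partial\Omega\}$. On each $\Gamma\in\Gamma_h^I$ fix a unit normal $\nu$, pointing from one adjacent element $E_-$ to the other one $E_+$; let $g_\pm$ be the trace of $g$ on $\Gamma$ from $E_\pm$, and $[g]_\Gamma=g_+-g_-$. Let $Q_h$ be the space of functions that are constant on each element, and $\mathbf V_h$ the space of vector fields $\mathbf v$ that are affine on each element with $\int_\Gamma[\mathbf v]_\Gamma\,dS=0$ for all $\Gamma\in\Gamma_h^I$ and $\int_\Gamma\mathbf v\,dS=0$ for all faces $\Gamma\subset\partial\Omega$.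 Write $\operatorname{div}_h$, $\operatorname{curl}_h$ for the elementwise divergence and curl, and $$(\mathbf u\cdot\nu)_h^{\pm}=\Big(\frac1{|\Gamma|}\int_\Gamma\mathbf u\cdot\nu\,dS\Big)^{\pm},\qquad a^+=\max(a,0),\quad a^-=\min(a,0).$$ Let $\Delta t>0$ and $M\in\mathbb N$ with $M\Delta t=T$, $t^m=m\Delta t$, and let $\mathbf f_h^m$ be the piecewise constant field with value $\frac1{\Delta t}\int_{t^{m-1}}^{t^m}\frac1{|E|}\int_E\mathbf f(s,x)\,dx\,ds$ on $E\in E_h$. Then for every $\varrho_h^0\in Q_h$ with $\varrho_h^0>0$ there exist $(\varrho_h^m,\mathbf u_h^m)\in Q_h\times\mathbf V_h$ with $\varrho_h^m>0$, $m=1,\dots,M$, such that for every $m=1,\dots,M$ $$\int_\Omega\frac{\varrho_h^m-\varrho_h^{m-1}}{\Delta t}\,\phi_h\,dx=\sum_{\Gamma\in\Gamma_h^I}\int_\Gamma\big(\varrho^m_-(\mathbf u_h^m\cdot\nu)_h^++\varrho^m_+(\mathbf u_h^m\cdot\nu)_h^-\big)[\phi_h]_\Gamma\,dS\qquad\forall\phi_h\in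 Q_h,$$ and $$\int_\Omega\mu\operatorname{curl}_h\mathbf u_h^m\cdot\operatorname{curl}_h\mathbf v_h+\big[(\mu+\lambda)\operatorname{div}_h\mathbf u_h^m-p(\varrho_h^m)\big]\operatorname{div}_h\mathbf v_h\,dx+\mu\sum_{\Gamma\in\Gamma_h^I}h^{\epsilon-1}\int_\Gamma[\mathbf u_h^m\cdot\nu]_\Gamma[\mathbf v_h\cdot\nu]_\Gamma+[\mathbf u_h^m\times\nu]_\Gamma\cdot[\mathbf v_h\times\nu]_\Gamma\,dS=\int_\Omega\mathbf f_h^m\cdot\mathbf v_h\,dx\qquad\forall\mathbf v_h\in\mathbf V_h.$$ -/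

import Mathlib

open Set MeasureTheory
open scoped BigOperators

noncomputable section

namespace CompressibleStokes

/-- The space `ℝ^N` with its Euclidean norm and inner product. -/
abbrev Pt (N : ℕ) : Type := EuclideanSpace ℝ (Fin N)

/-! ### Simplicial meshes -/

/-- A (conforming) mesh of `Ω ⊆ ℝ^N` by triangles (`N = 2`) or tetrahedra (`N = 3`): a finite
simplicial complex all of whose maximal simplices are `N`-dimensional and whose union is the
closure of `Ω`. Every simplex is represented by its finite set of vertices. -/
structure Mesh (N : ℕ) (Ω : Set (Pt N)) extends Geometry.SimplicialComplex ℝ (Pt N) where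
  finite_faces : faces.Finite
  pure : ∀ s ∈ faces, ∃ t ∈ faces, s ⊆ t ∧ t.card = N + 1
  space_eq : toSimplicialComplex.space = closure Ω

variable {N : ℕ} {Ω : Set (Pt N)}

/-- The closed simplex with vertex set `s`. -/
def simplex (s : Finset (Pt N)) : Set (Pt N) := convexHull ℝ (s : Set (Pt N))

namespace Mesh

/-- The elements `E ∈ E_h` of the mesh, given by their `N + 1` vertices. -/
def Elem (T : Mesh N Ω) : Type := {E : Finset (Pt N) // E ∈ T.faces ∧ E.card = N + 1}

/-- The faces `Γ ∈ Γ_h` of the mesh, given by their `N` vertices. -/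
def Face (T : Mesh N Ω) : Type := {F : Finset (Pt N) // F ∈ T.faces ∧ F.card = N}

/-- The internal faces `Γ ∈ Γ_h^I`: the faces that are not contained in `∂Ω`. -/
def InnerFace (T : Mesh N Ω) : Type := {F : T.Face // ¬ simplex F.1 ⊆ frontier Ω}

instance (T : Mesh N Ω) : Finite T.Elem :=
  (T.finite_faces.subset fun _ h => h.1 :
    {E : Finset (Pt N) | E ∈ T.faces ∧ E.card = N + 1}.Finite).to_subtype

instance (T : Mesh N Ω) : Finite T.Face :=
  (T.finite_faces.subset fun _ h => h.1 :
    {F : Finset (Pt N) | F ∈ T.faces ∧ F.card = N}.Finite).to_subtype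

instance (T : Mesh N Ω) : Finite T.InnerFace :=
  inferInstanceAs (Finite {F : T.Face // ¬ simplex F.1 ⊆ frontier Ω})

instance (T : Mesh N Ω) : Fintype T.Elem := Fintype.ofFinite _

instance (T : Mesh N Ω) : Fintype T.InnerFace := Fintype.ofFinite _

/-- The closed set occupied by an element. -/
def Elem.carrier {T : Mesh N Ω} (E : T.Elem) : Set (Pt N) := simplex E.1

/-- The closed set occupied by an internal face. -/
def InnerFace.carrier {T : Mesh N Ω} (F : T.InnerFace) : Set (Pt N) := simplex F.1.1

/-- The mesh size `h`: the maximal diameter of the elements. -/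
def size (T : Mesh N Ω) : ℝ := ⨆ E : T.Elem, Metric.diam E.carrier

/-- A choice, on every internal face `Γ`, of one of the two unit normals `ν`. The elements
sharing `Γ` are named `E₋ = minus Γ` and `E₊ = plus Γ` so that `ν` points from `E₋` to `E₊`. -/
structure Orientation (T : Mesh N Ω) where
  normal : T.InnerFace → Pt N
  minus : T.InnerFace → T.Elem
  plus : T.InnerFace → T.Elem
  norm_normal : ∀ F, ‖normal F‖ = 1
  normal_orthogonal : ∀ F, ∀ x ∈ F.1.1, ∀ y ∈ F.1.1, inner ℝ (normal F) (x - y) = 0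
  subset_minus : ∀ F, F.1.1 ⊆ (minus F).1
  subset_plus : ∀ F, F.1.1 ⊆ (plus F).1
  minus_side : ∀ F, ∀ p ∈ (minus F).1, p ∉ F.1.1 → ∀ x ∈ F.1.1, inner ℝ (normal F) (p - x) < 0
  plus_side : ∀ F, ∀ p ∈ (plus F).1, p ∉ F.1.1 → ∀ x ∈ F.1.1, 0 < inner ℝ (normal F) (p - x)

end Mesh

/-! ### Vector calculus in `ℝ^N`, `N = 2, 3`

The curl of a vector field and the product `a × b` are represented by the skew matrices
`∂ᵢ uⱼ - ∂ⱼ uᵢ` and `aᵢ bⱼ - aⱼ bᵢ`, and the product of two such quantities is taken over the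
pairs `i < j`. For `N = 2` this is the product of the usual scalars, for `N = 3` it is the scalar
product of the usual vectors; see the four lemmas at the end of this section. -/

/-- The partial derivative `∂ᵢ uⱼ` of an affine field. -/
def pderiv (u : Pt N →ᵃ[ℝ] Pt N) (i j : Fin N) : ℝ := u.linear (EuclideanSpace.single i 1) j

/-- The divergence of an affine field. -/
def divg (u : Pt N →ᵃ[ℝ] Pt N) : ℝ := ∑ i, pderiv u i i

/-- The curl of an affine field. -/
def curl (u : Pt N →ᵃ[ℝ] Pt N) (i j : Fin N) : ℝ := pderiv u i j - pderiv u j i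

/-- The product `a × b`. -/
def cross (a b : Pt N) (i j : Fin N) : ℝ := a i * b j - a j * b i

/-- The product of two curls, or of two cross products. -/
def skewDot (A B : Fin N → Fin N → ℝ) : ℝ := ∑ i, ∑ j, if i < j then A i j * B i j else 0

theorem skewDot_curl_two (u v : Pt 2 →ᵃ[ℝ] Pt 2) :
    skewDot (curl u) (curl v) =
      (pderiv u 0 1 - pderiv u 1 0) * (pderiv v 0 1 - pderiv v 1 0) := by
  simp [skewDot, curl, Fin.sum_univ_two]

theorem skewDot_cross_two (a b n : Pt 2) :
    skewDot (cross a n) (cross b n) = (a 0 * n 1 - a 1 * n 0) * (b 0 * n 1 - b 1 * n 0) := by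
  simp [skewDot, cross, Fin.sum_univ_two]

theorem skewDot_curl_three (u v : Pt 3 →ᵃ[ℝ] Pt 3) :
    skewDot (curl u) (curl v) =
      dotProduct
        ![pderiv u 1 2 - pderiv u 2 1, pderiv u 2 0 - pderiv u 0 2, pderiv u 0 1 - pderiv u 1 0]
        ![pderiv v 1 2 - pderiv v 2 1, pderiv v 2 0 - pderiv v 0 2, pderiv v 0 1 - pderiv v 1 0] := by
  simp [skewDot, curl, Fin.sum_univ_three, dotProduct]
  ring

theorem skewDot_cross_three (a b n : Pt 3) :
    skewDot (cross a n) (cross b n) =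
      dotProduct (crossProduct a.ofLp n.ofLp) (crossProduct b.ofLp n.ofLp) := by
  simp [skewDot, cross, Fin.sum_univ_three, dotProduct, cross_apply]
  ring

/-! ### Finite element spaces -/

/-- `Q_h(Ω)`: functions that are constant on each element, given by their values. -/
abbrev PwConst (T : Mesh N Ω) : Type := T.Elem → ℝ

/-- Vector fields whose restriction to each element `E` belongs to `P₁(E)^N`, given by these
restrictions (an affine field on `E` extends uniquely to `ℝ^N`). -/
abbrev PwAffine (T : Mesh N Ω) : Type := T.Elem → (Pt N →ᵃ[ℝ] Pt N)

/-- Surface measure `dS` on the faces: the `(N - 1)`-dimensional Hausdorff measure, normalized as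
length for `N = 2` and as area for `N = 3`. -/
def surf (N : ℕ) : Measure (Pt N) := Measure.euclideanHausdorffMeasure (N - 1)

/-- The jump `⟦v⟧_Γ = v₊ - v₋` at a point of an internal face. -/
def jump {T : Mesh N Ω} (o : T.Orientation) (v : PwAffine T) (F : T.InnerFace) (x : Pt N) : Pt N :=
  v (o.plus F) x - v (o.minus F) x

/-- The Crouzeix-Raviart space `V_h(Ω)`: the mean of the jump over every internal face vanishes,
and so does the mean of the field over every face contained in `∂Ω`. -/
def crouzeixRaviart {T : Mesh N Ω} (o : T.Orientation) : Set (PwAffine T) :=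
  {v | (∀ F : T.InnerFace, ∫ x in F.carrier, jump o v F x ∂(surf N) = 0) ∧
    ∀ F : T.Face, simplex F.1 ⊆ frontier Ω → ∀ E : T.Elem, F.1 ⊆ E.1 →
      ∫ x in simplex F.1, v E x ∂(surf N) = 0}

/-! ### The numerical scheme -/

/-- The average normal velocity `|Γ|⁻¹ ∫_Γ u · ν dS` on an internal face. For `u ∈ V_h(Ω)` the
traces of `u` from both sides have the same average; the one from `E₋` is used here. -/
def avgNormal {T : Mesh N Ω} (o : T.Orientation) (u : PwAffine T) (F : T.InnerFace) : ℝ :=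
  ⨍ x in F.carrier, inner ℝ (u (o.minus F) x) (o.normal F) ∂(surf N)

/-- The value on `E` of `f_h^m = (1/Δt) ∫_{t^{m-1}}^{t^m} Π_h^Q f(s, ·) ds`, with `t^m = m Δt`. -/
def force {T : Mesh N Ω} (Δt : ℝ) (f : ℝ → Pt N → Pt N) (m : ℕ) (E : T.Elem) : Pt N :=
  (1 / Δt) • ∫ s in (((m : ℝ) - 1) * Δt)..((m : ℝ) * Δt), ⨍ x in E.carrier, f s x

/-- The discrete continuity equation for one time step, `r` being the old and `ρ` the new
density:
`∫_Ω (ρ - r)/Δt φ dx = ∑_Γ ∫_Γ (ρ₋ (u·ν)_h⁺ + ρ₊ (u·ν)_h⁻) ⟦φ⟧ dS` for all `φ ∈ Q_h(Ω)`. -/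
def ContinuityEq {T : Mesh N Ω} (o : T.Orientation) (Δt : ℝ) (r ρ : PwConst T) (u : PwAffine T) :
    Prop :=
  ∀ φ : PwConst T,
    ∑ E : T.Elem, ∫ _x in E.carrier, (ρ E - r E) / Δt * φ E =
      ∑ F : T.InnerFace, ∫ _x in F.carrier,
        (ρ (o.minus F) * max (avgNormal o u F) 0 + ρ (o.plus F) * min (avgNormal o u F) 0) *
          (φ (o.plus F) - φ (o.minus F)) ∂(surf N)

/-- The discrete momentum equation with pressure `p(ρ) = a ρ^γ` and piecewise constant force `g`,
tested with all `v ∈ V_h(Ω)`. -/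
def MomentumEq {T : Mesh N Ω} (o : T.Orientation) (μ lam a γ ε : ℝ) (g : T.Elem → Pt N)
    (ρ : PwConst T) (u : PwAffine T) : Prop :=
  ∀ v ∈ crouzeixRaviart o,
    (∑ E : T.Elem, ∫ _x in E.carrier,
        (μ * skewDot (curl (u E)) (curl (v E)) +
          ((μ + lam) * divg (u E) - a * ρ E ^ γ) * divg (v E))) +
      μ * ∑ F : T.InnerFace, T.size ^ (ε - 1) *
        ∫ x in F.carrier,
          (inner ℝ (jump o u F x) (o.normal F) * inner ℝ (jump o v F x) (o.normal F) +
            skewDot (cross (jump o u F x) (o.normal F)) (cross (jump o v F x) (o.normal F)))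
          ∂(surf N) =
      ∑ E : T.Elem, ∫ x in E.carrier, inner ℝ (g E) (v E x)

/-- `(ρ^m, u^m)`, `m = 1, …, M`, is a solution of the numerical scheme with initial density
`ρ^0 = ρ₀`, time step `Δt` and force `f`. -/
structure IsDiscreteSolution {T : Mesh N Ω} (o : T.Orientation) (μ lam a γ ε Δt : ℝ) (M : ℕ)
    (f : ℝ → Pt N → Pt N) (ρ₀ : PwConst T) (ρ : ℕ → PwConst T) (u : ℕ → PwAffine T) : Prop where
  initial : ρ 0 = ρ₀
  mem_space : ∀ m, 1 ≤ m → m ≤ M → u m ∈ crouzeixRaviart o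
  continuity : ∀ m, 1 ≤ m → m ≤ M → ContinuityEq o Δt (ρ (m - 1)) (ρ m) (u m)
  momentum : ∀ m, 1 ≤ m → m ≤ M → MomentumEq o μ lam a γ ε (force Δt f m) (ρ m) (u m)

end CompressibleStokes

end

/-!
One time step asks for a density `ρ` and a field `u` of the Crouzeix-Raviart space `V_h` that solve
a linear elliptic equation, driven by the pressure `p(ρ)`, and an implicit upwind step, driven by
the fluxes of `u`. The time steps are then solved one after the other.

*The density as a function of the velocity.* For given fluxes `β` through the inner faces the upwind
step is a linear system for `ρ`. Testing with the indicator function of `{ρ ≤ 0}` shows that its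
matrix is invertible and that a positive old density gives a positive new one (`UpwindEq.pos`). By
Cramer's rule the solution depends continuously on `β` (`continuous_upwindSol`). Testing with
`P'(ρ) = γ / (γ - 1) ρ ^ (γ - 1)` and convexity give the energy estimate
`∑ β (ρ₋ ^ γ - ρ₊ ^ γ) ≤ C`, where `C` depends only on the old density (`UpwindEq.energy`).

*A priori estimate and existence.* By the discrete divergence theorem, the left-hand side of the
energy estimate, multiplied by `a`, is `∫ p(ρ) div_h u`. Hence the residual `Φ(u)` of the momentum
equation with `ρ = ρ(u)` satisfies `⟨Φ(u), u⟩ ≥ c |u|² - a C - G |u|`, so that `Φ` points outwards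
on large spheres. A continuous vector field with this property has a zero
(`exists_eq_zero_of_inner_pos`). This form of Brouwer's theorem follows from the absence of smooth
retractions onto a sphere: for a retraction `f` the integral of `det (1 + t (Df - 1))` over the ball
is a polynomial in `t`, equal to the volume of the ball for small `t` and to `0` for `t = 1`.

*Geometry.* The divergence theorem is needed only for affine fields on simplices (`sum_flux`). The
Hausdorff measure of a face is related to the volume of the element by slicing the pyramid over the
face (`volume_simplex_eq`), and the mean over a face is the mean over the vertices by the layer cake
formula (`integral_affineMap_oppFace`). In the mesh, an inner face belongs to exactly two elements
(`Mesh.Orientation.eq_minus_or_eq_plus`), so the contributions of the faces combine to jumps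
(`Mesh.Orientation.sum_volume_mul_divg`).

*Definiteness.* If the energy of `u ∈ V_h` vanishes, then `u` has no jumps and its elementwise
gradients are symmetric and trace free; such gradients do not jump over faces either. The divergence
theorem for the field `∇u u` then shows `∇u = 0`, and the divergence theorem for `|u|² x` shows
`u = 0` (`Mesh.Orientation.eq_zero_of_curl_divg_jump`).
-/

noncomputable section

open Metric Filter Topology Module
open scoped ContDiff RealInnerProductSpace

namespace CompressibleStokes

/-! ### A vector field pointing outwards has a zero -/

section Brouwer

variable {V : Type*} [NormedAddCommGroup V] [InnerProductSpace ℝ V] [FiniteDimensional ℝ V]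

/-- Lagrange interpolation of the polynomial `t ↦ det (1 + t • M)`, with nodes `0, …, n`. -/
theorem det_one_add_smul_eq_sum (M : V →L[ℝ] V) (t : ℝ) :
    (1 + t • M).det = ∑ i ∈ Finset.range (finrank ℝ V + 1), (1 + (i : ℝ) • M).det *
      (Lagrange.basis (Finset.range (finrank ℝ V + 1)) (fun i : ℕ => (i : ℝ)) i).eval t := by
  classical
  set e := finBasis ℝ V
  set A := LinearMap.toMatrix e e (M : V →ₗ[ℝ] V)
  set Q : Polynomial ℝ := ((Polynomial.X : Polynomial ℝ) • A.map Polynomial.C +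
    (1 : Matrix _ _ ℝ).map Polynomial.C).det
  have hQ : ∀ s : ℝ, Q.eval s = (1 + s • M).det := by
    intro s
    have h1 : Q.eval s = (1 + s • A).det := by
      rw [← Polynomial.coe_evalRingHom, RingHom.map_det]
      congr 1
      ext i j
      simp [Matrix.one_apply, add_comm, apply_ite, mul_comm s]
    rw [h1, ContinuousLinearMap.det, ← LinearMap.det_toMatrix e]
    congr 1
    simp only [A, ContinuousLinearMap.toLinearMap_add, ContinuousLinearMap.toLinearMap_smul, map_add, map_smul]
    congr 1
    exact (LinearMap.toMatrix_one e).symm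
  have hdeg : Q.degree < (Finset.range (finrank ℝ V + 1)).card := by
    rw [Finset.card_range]
    refine lt_of_le_of_lt Polynomial.degree_le_natDegree ?_
    have := Polynomial.natDegree_det_X_add_C_le A 1
    rw [Fintype.card_fin] at this
    exact_mod_cast Nat.lt_succ_of_le this
  have := Lagrange.eq_interpolate (v := fun i : ℕ => (i : ℝ)) (f := Q)
    (s := Finset.range (finrank ℝ V + 1)) (Nat.cast_injective.injOn) hdeg
  rw [← hQ, this, Lagrange.interpolate_apply, Polynomial.eval_finsetSum]
  refine Finset.sum_congr rfl fun i _ => ?_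
  rw [Polynomial.eval_mul, Polynomial.eval_C, hQ]

variable [MeasurableSpace V] [BorelSpace V]

/-- There is no `C¹` map onto a sphere that fixes the sphere. -/
theorem not_exists_retraction {f : V → V} (hf : ContDiff ℝ 1 f) {S : ℝ} (hS : 0 < S)
    (hfS : ∀ x, ‖f x‖ = S) (hfix : ∀ x, ‖x‖ = S → f x = x) : False := by
  set k : V → V := fun x => f x - x with hk
  have hkC : ContDiff ℝ 1 k := hf.sub contDiff_id
  set B : Set V := ball 0 S
  set D : Set V := closedBall 0 S
  have hBD : B ⊆ D := ball_subset_closedBall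
  have hDc : IsCompact D := isCompact_closedBall 0 S
  have hDk : Continuous (fderiv ℝ k) := hkC.continuous_fderiv one_ne_zero
  have hdetc : Continuous fun z : ℝ × V => (1 + z.1 • fderiv ℝ k z.2).det :=
    ContinuousLinearMap.continuous_det.comp
      (continuous_const.add (continuous_fst.smul (hDk.comp continuous_snd)))
  obtain ⟨C, hC⟩ := hkC.contDiffOn.exists_lipschitzOnWith one_ne_zero (convex_closedBall 0 S) hDc
  have hder : ∀ (t : ℝ) (x : V),
      HasFDerivAt (fun x => x + t • k x) (1 + t • fderiv ℝ k x) x := fun t x =>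
    (hasFDerivAt_id x).add (((hkC.differentiable one_ne_zero) x).hasFDerivAt.const_smul t)
  have hhc : ∀ t : ℝ, ContDiff ℝ 1 fun x => x + t • k x := fun t =>
    contDiff_id.add (contDiff_const.smul hkC)
  have hconv : ∀ (t : ℝ) (x : V), 0 ≤ t → t ≤ 1 → ‖x + t • k x‖ ≤ (1 - t) * ‖x‖ + t * S := by
    intro t x h0 h1
    have : x + t • k x = (1 - t) • x + t • f x := by simp only [hk]; module
    rw [this]
    refine (norm_add_le _ _).trans ?_
    rw [norm_smul, norm_smul, hfS, Real.norm_of_nonneg h0, Real.norm_of_nonneg (by linarith)]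
  -- For small `t > 0` the map `x ↦ x + t • k x` is a bijection of the open ball.
  have hsmall : ∀ᶠ t in 𝓝[>] (0 : ℝ), ∫ x in B, (1 + t • fderiv ℝ k x).det = volume.real B := by
    have h1 : ∀ᶠ t in 𝓝 (0 : ℝ), ∀ x ∈ D, 0 < (1 + t • fderiv ℝ k x).det := by
      refine hDc.eventually_forall_of_forall_eventually fun x _ => ?_
      refine hdetc.continuousAt.eventually (lt_mem_nhds (a := (0 : ℝ)) ?_)
      simp [ContinuousLinearMap.det]
    have h2 : ∀ᶠ t : ℝ in 𝓝 0, t * C < 1 := by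
      have : Continuous fun t : ℝ => t * C := by fun_prop
      refine this.continuousAt.eventually (gt_mem_nhds ?_)
      simp
    have h3 : ∀ᶠ t in 𝓝 (0 : ℝ), t < 1 := gt_mem_nhds one_pos
    filter_upwards [nhdsWithin_le_nhds h1, nhdsWithin_le_nhds h2, nhdsWithin_le_nhds h3,
      self_mem_nhdsWithin] with t hdet htC ht1 ht0
    have ht0 : 0 < t := ht0
    have hinj : InjOn (fun x => x + t • k x) D := by
      intro x hx y hy hxy
      have hxy : x + t • k x = y + t • k y := hxy
      have e1 : x - y = t • (k y - k x) := by
        rw [smul_sub, sub_eq_sub_iff_add_eq_add, hxy, add_comm]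
      have e2 : ‖x - y‖ ≤ t * (C * ‖x - y‖) := by
        have h4 := hC.dist_le_mul y hy x hx
        rw [dist_eq_norm, dist_eq_norm, norm_sub_rev y x] at h4
        calc ‖x - y‖ = t * ‖k y - k x‖ := by
              conv_lhs => rw [e1]
              rw [norm_smul, Real.norm_of_nonneg ht0.le]
          _ ≤ _ := by gcongr
      by_contra hne
      have : 0 < ‖x - y‖ := norm_pos_iff.2 (sub_ne_zero.2 hne)
      nlinarith
    have himg : (fun x => x + t • k x) '' B = B := by
      apply Subset.antisymm
      · rintro _ ⟨x, hx, rfl⟩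
        have hx' : ‖x‖ < S := by simpa [B] using hx
        have := hconv t x ht0.le ht1.le
        have : ‖x + t • k x‖ < S := by nlinarith
        simpa [B] using this
      · refine (convex_ball (0 : V) S).isPreconnected.subset_of_closure_inter_subset ?_ ?_ ?_
        · rw [isOpen_iff_mem_nhds]
          rintro _ ⟨x, hx, rfl⟩
          have hs : HasStrictFDerivAt (fun x => x + t • k x) (1 + t • fderiv ℝ k x) x :=
            (hhc t).contDiffAt.hasStrictFDerivAt' (hder t x) one_ne_zero
          rw [← ContinuousLinearMap.coe_toContinuousLinearEquivOfDetNeZero _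
            (hdet x (hBD hx)).ne'] at hs
          rw [← hs.map_nhds_eq_of_equiv]
          exact image_mem_map (isOpen_ball.mem_nhds hx)
        · refine ⟨(0 : V) + t • k 0, ?_, mem_image_of_mem _ (mem_ball_self hS)⟩
          have := hconv t 0 ht0.le ht1.le
          rw [norm_zero] at this
          have : ‖(0 : V) + t • k 0‖ < S := by nlinarith
          simpa [B] using this
        · rintro z ⟨hz, hzB⟩
          have hcl : closure ((fun x => x + t • k x) '' B) ⊆ (fun x => x + t • k x) '' D :=
            closure_minimal (image_mono hBD) (hDc.image (hhc t).continuous).isClosed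
          obtain ⟨x, hx, rfl⟩ := hcl hz
          rcases lt_or_eq_of_le (mem_closedBall_zero_iff.1 hx) with h | h
          · exact mem_image_of_mem _ (mem_ball_zero_iff.2 h)
          · exfalso
            have : k x = 0 := by simp [hk, hfix x h]
            have h5 : ‖x + t • k x‖ < S := by simpa [B] using hzB
            rw [this, smul_zero, add_zero] at h5
            exact h5.ne h
    have hcv := integral_image_eq_integral_abs_det_fderiv_smul (volume : Measure V)
      (measurableSet_ball : MeasurableSet B) (fun x _ => (hder t x).hasFDerivWithinAt)
      (hinj.mono hBD) (fun _ => (1 : ℝ))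
    rw [himg] at hcv
    rw [setIntegral_const, smul_eq_mul, mul_one] at hcv
    rw [hcv]
    refine setIntegral_congr_fun measurableSet_ball fun x hx => ?_
    simp [abs_of_pos (hdet x (hBD hx))]
  -- The integral is a polynomial in `t`, hence constant.
  set s := Finset.range (finrank ℝ V + 1)
  set P : Polynomial ℝ := ∑ i ∈ s, Polynomial.C (∫ x in B, (1 + (i : ℝ) • fderiv ℝ k x).det) *
      Lagrange.basis s (fun i : ℕ => (i : ℝ)) i with hP
  have hPe : ∀ t, P.eval t = ∫ x in B, (1 + t • fderiv ℝ k x).det := by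
    intro t
    simp_rw [det_one_add_smul_eq_sum _ t]
    rw [integral_finsetSum]
    · rw [hP, Polynomial.eval_finsetSum]
      refine Finset.sum_congr rfl fun i _ => ?_
      rw [Polynomial.eval_mul, Polynomial.eval_C, integral_mul_const]
    · intro i _
      refine Integrable.mul_const ?_ _
      have : Continuous fun x => (1 + (i : ℝ) • fderiv ℝ k x).det :=
        hdetc.comp (continuous_const.prodMk continuous_id)
      exact (this.continuousOn.integrableOn_compact hDc).mono_set hBD
  have hPc : P = Polynomial.C (volume.real B) := by
    refine Polynomial.eq_of_infinite_eval_eq _ _ ?_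
    obtain ⟨u, hu, hsub⟩ := mem_nhdsGT_iff_exists_Ioo_subset.1 hsmall
    refine (Ioo_infinite hu).mono fun t ht => ?_
    have : ∫ x in B, (1 + t • fderiv ℝ k x).det = volume.real B := hsub ht
    simp [hPe, this]
  have hone : P.eval 1 = 0 := by
    rw [hPe]
    refine setIntegral_eq_zero_of_forall_eq_zero fun x _ => ?_
    have hfd : HasFDerivAt f (1 + (1 : ℝ) • fderiv ℝ k x) x := by
      have := hder 1 x
      simpa [hk] using this
    by_contra hne
    have hn : HasFDerivAt (fun y => ⟪f y, f y⟫) (0 : V →L[ℝ] ℝ) x := by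
      have : (fun y => ⟪f y, f y⟫) = fun _ => S ^ 2 := by
        ext y; rw [real_inner_self_eq_norm_sq, hfS]
      rw [this]; exact hasFDerivAt_const _ _
    have h6 := (hfd.inner ℝ hfd).unique hn
    set e := (1 + (1 : ℝ) • fderiv ℝ k x).toContinuousLinearEquivOfDetNeZero hne
    have he : ∀ w, (1 + (1 : ℝ) • fderiv ℝ k x) w = e w := fun w => by
      rw [← ContinuousLinearEquiv.coe_coe,
        ContinuousLinearMap.coe_toContinuousLinearEquivOfDetNeZero]
    have h7 := congrArg (fun L => L (e.symm (f x))) h6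
    simp only [ContinuousLinearMap.comp_apply, ContinuousLinearMap.prod_apply, fderivInnerCLM_apply, he,
      ContinuousLinearEquiv.apply_symm_apply, zero_apply] at h7
    rw [real_inner_self_eq_norm_sq, hfS] at h7
    nlinarith
  rw [hPc, Polynomial.eval_C] at hone
  have : 0 < volume.real B := (ENNReal.toReal_pos (measure_ball_pos _ _ hS).ne' measure_ball_lt_top.ne)
  linarith

/-- A form of Brouwer's theorem: a continuous vector field that points outwards on all large
spheres has a zero. -/
theorem exists_eq_zero_of_inner_pos {F : V → V} (hF : Continuous F) {R : ℝ} (hR : 0 < R)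
    (h : ∀ x, R ≤ ‖x‖ → 0 < ⟪F x, x⟫) : ∃ x, F x = 0 := by
  by_contra! hne
  -- The convex constraints make a smooth selection zero free, and equal to the identity
  -- outside a ball.
  set t : V → Set V := fun x => {y | (‖x‖ ≤ R → 0 < ⟪y, F x⟫) ∧ (R ≤ ‖x‖ → 0 < ⟪y, x⟫) ∧
    (R + 1 ≤ ‖x‖ → y = x)}
  have htc : ∀ x, Convex ℝ (t x) := by
    intro x y hy z hz a b ha hb hab
    have key : ∀ w : V, 0 < ⟪y, w⟫ → 0 < ⟪z, w⟫ → 0 < ⟪a • y + b • z, w⟫ := by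
      intro w h1 h2
      rw [inner_add_left, real_inner_smul_left, real_inner_smul_left]
      rcases ha.eq_or_lt with rfl | ha
      · have : b = 1 := by linarith
        subst this; simpa using h2
      · have := mul_pos ha h1
        have := mul_nonneg hb h2.le
        linarith
    refine ⟨fun hx => key _ (hy.1 hx) (hz.1 hx), fun hx => key _ (hy.2.1 hx) (hz.2.1 hx),
      fun hx => ?_⟩
    rw [hy.2.2 hx, hz.2.2 hx, ← add_smul, hab, one_smul]
  obtain ⟨G, hG⟩ := exists_contMDiffMap_forall_mem_convex_of_local (n := 1) (modelWithCornersSelf ℝ V)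
    (t := t) htc (by
      intro x
      rcases lt_or_ge ‖x‖ (R + 1) with hx | hx
      · have h1 : ∀ᶠ y in 𝓝 x, 0 < ⟪F x, F y⟫ := by
          have : Continuous fun y => ⟪F x, F y⟫ := by fun_prop
          exact this.continuousAt.eventually
            (lt_mem_nhds (real_inner_self_pos.2 (hne x)))
        have h2 : ∀ᶠ y in 𝓝 x, R ≤ ‖y‖ → 0 < ⟪F x, y⟫ := by
          rcases lt_or_ge ‖x‖ R with hxR | hxR
          · filter_upwards [continuous_norm.continuousAt.eventually (gt_mem_nhds hxR)] with y hy hy'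
            exact absurd hy (not_lt.2 hy')
          · have : Continuous fun y => ⟪F x, y⟫ := by fun_prop
            filter_upwards [this.continuousAt.eventually (lt_mem_nhds (h x hxR))] with y hy _
            exact hy
        have h3 : ∀ᶠ y in 𝓝 x, ‖y‖ < R + 1 :=
          continuous_norm.continuousAt.eventually (gt_mem_nhds hx)
        exact ⟨_, h1.and (h2.and h3), fun _ => F x, contMDiffOn_const, fun y hy =>
          ⟨fun _ => hy.1, hy.2.1, fun hy' => absurd hy.2.2 (not_lt.2 hy')⟩⟩
      · have h3 : ∀ᶠ y in 𝓝 x, R < ‖y‖ :=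
          continuous_norm.continuousAt.eventually (lt_mem_nhds (by linarith))
        refine ⟨_, h3, id, contMDiffOn_id, fun y hy => ?_⟩
        have hy : R < ‖y‖ := hy
        exact ⟨fun hy' => absurd hy (not_lt.2 hy'),
          fun _ => real_inner_self_pos.2 (norm_pos_iff.1 (hR.trans hy)), fun _ => rfl⟩)
  have hGs : ContDiff ℝ 1 G := contMDiff_iff_contDiff.1 G.contMDiff
  have hG0 : ∀ x, G x ≠ 0 := by
    intro x hx
    rcases le_total ‖x‖ R with hxR | hxR
    · simpa [hx] using (hG x).1 hxR
    · simpa [hx] using (hG x).2.1 hxR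
  refine not_exists_retraction (f := fun x => ((R + 1) / ‖G x‖) • G x)
    ((contDiff_const.div (hGs.norm ℝ hG0) fun x => norm_ne_zero_iff.2 (hG0 x)).smul hGs)
    (S := R + 1) (by linarith) (fun x => ?_) fun x hx => ?_
  · have := norm_ne_zero_iff.2 (hG0 x)
    rw [norm_smul, norm_div, norm_norm, div_mul_cancel₀ _ this, Real.norm_of_nonneg (by linarith)]
  · rw [(hG x).2.2 hx.ge, hx, div_self (by linarith), one_smul]

end Brouwer

/-! ### Volume, surface measure and fluxes on a simplex -/

section Simplex

variable {N : ℕ} {ι : Type*} [Fintype ι] [DecidableEq ι]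

/-- The closed face opposite to the vertex `b p` of the simplex spanned by `b`. -/
def oppFace (b : AffineBasis ι ℝ (Pt N)) (p : ι) : Set (Pt N) := convexHull ℝ (b '' {p}ᶜ)

variable (b : AffineBasis ι ℝ (Pt N)) (p : ι)

omit [DecidableEq ι] in
theorem affineMap_eq_sum_coord (l : Pt N →ᵃ[ℝ] ℝ) (x : Pt N) :
    l x = ∑ i, b.coord i x * l (b i) := by
  conv_lhs => rw [← b.affineCombination_coord_eq_self x]
  rw [Finset.map_affineCombination _ _ _ (b.sum_coord_apply_eq_one x),
    Finset.affineCombination_eq_linear_combination _ _ _ (b.sum_coord_apply_eq_one x)]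
  rfl

theorem mem_oppFace_iff {x : Pt N} :
    x ∈ oppFace b p ↔ b.coord p x = 0 ∧ ∀ i, 0 ≤ b.coord i x := by
  constructor
  · intro hx
    have hconv : Convex ℝ {x | b.coord p x = 0 ∧ ∀ i, 0 ≤ b.coord i x} := by
      intro y hy z hz s t hs ht hst
      refine ⟨?_, fun i => ?_⟩
      · rw [Convex.combo_affine_apply hst, hy.1, hz.1]; simp
      · rw [Convex.combo_affine_apply hst]
        exact add_nonneg (mul_nonneg hs (hy.2 i)) (mul_nonneg ht (hz.2 i))
    refine convexHull_min ?_ hconv hx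
    rintro _ ⟨i, hi, rfl⟩
    refine ⟨b.coord_apply_ne (Ne.symm hi), fun j => ?_⟩
    rw [b.coord_apply]; split_ifs <;> norm_num
  · rintro ⟨h0, hx⟩
    have h1 : ∑ i ∈ Finset.univ.erase p, b.coord i x = 1 := by
      rw [Finset.sum_erase (f := fun i => b.coord i x) _ h0, b.sum_coord_apply_eq_one]
    have h2 : ∑ i ∈ Finset.univ.erase p, b.coord i x • b i = x := by
      rw [Finset.sum_erase (f := fun i => b.coord i x • b i) _ (by rw [h0, zero_smul]), b.linear_combination_coord_eq_self]
    rw [← h2]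
    refine (convex_convexHull ℝ _).sum_mem (fun i _ => hx i) h1 fun i hi => ?_
    exact subset_convexHull ℝ _ (mem_image_of_mem _ (Finset.ne_of_mem_erase hi))

omit [Fintype ι] [DecidableEq ι] in
theorem coord_homothety (q i : ι) (c : ℝ) (x : Pt N) :
    b.coord i (AffineMap.homothety (b q) c x) = c * b.coord i x + (1 - c) * b.coord i (b q) := by
  rw [AffineMap.homothety_eq_lineMap, AffineMap.apply_lineMap, AffineMap.lineMap_apply_ring]
  ring

omit [DecidableEq ι] in
theorem isCompact_simplex : IsCompact (convexHull ℝ (range b)) :=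
  (finite_range b).isCompact_convexHull ℝ

omit [DecidableEq ι] in
theorem isCompact_oppFace : IsCompact (oppFace b p) :=
  ((Set.toFinite _).image b).isCompact_convexHull ℝ

/-- The superlevel sets of a barycentric coordinate on a face are scaled copies of the face. -/
theorem oppFace_section {q : ι} (hq : q ≠ p) {c : ℝ} (hc : 0 < c) (hc1 : c ≤ 1) :
    {x ∈ oppFace b p | 1 - c ≤ b.coord q x} = AffineMap.homothety (b q) c '' oppFace b p := by
  ext x
  constructor
  · rintro ⟨hx, hxq⟩
    rw [mem_oppFace_iff] at hx
    refine ⟨AffineMap.homothety (b q) c⁻¹ x, ?_, ?_⟩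
    · rw [mem_oppFace_iff]
      refine ⟨?_, fun i => ?_⟩
      · rw [coord_homothety, hx.1, b.coord_apply_ne hq.symm]; ring
      · rw [coord_homothety, b.coord_apply]
        have : c⁻¹ * b.coord i x + (1 - c⁻¹) * (if i = q then 1 else 0) =
            c⁻¹ * (b.coord i x - (1 - c) * (if i = q then 1 else 0)) := by
          field_simp; ring
        rw [this]
        refine mul_nonneg (inv_nonneg.2 hc.le) ?_
        split_ifs with h
        · subst h; linarith
        · simpa using hx.2 i
    · refine b.ext_elem fun i => ?_
      rw [coord_homothety, coord_homothety]
      field_simp; ring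
  · rintro ⟨y, hy, rfl⟩
    rw [mem_oppFace_iff] at hy
    refine ⟨(mem_oppFace_iff b p).2 ⟨?_, fun i => ?_⟩, ?_⟩
    · rw [coord_homothety, hy.1, b.coord_apply_ne hq.symm]; ring
    · rw [coord_homothety, b.coord_apply]
      have := mul_nonneg hc.le (hy.2 i)
      split_ifs <;> linarith
    · rw [coord_homothety, b.coord_apply_eq]
      have := mul_nonneg hc.le (hy.2 q)
      linarith

/-- The sections of a simplex parallel to a face are scaled copies of the face. -/
theorem simplex_section {c : ℝ} (hc : 0 < c) (hc1 : c ≤ 1) :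
    {x ∈ convexHull ℝ (range b) | b.coord p x = 1 - c} =
      AffineMap.homothety (b p) c '' oppFace b p := by
  ext x
  rw [b.convexHull_eq_nonneg_coord]
  constructor
  · rintro ⟨hx, hxp⟩
    have hx : ∀ i, 0 ≤ b.coord i x := hx
    refine ⟨AffineMap.homothety (b p) c⁻¹ x, ?_, ?_⟩
    · rw [mem_oppFace_iff]
      refine ⟨?_, fun i => ?_⟩
      · rw [coord_homothety, hxp, b.coord_apply_eq]; field_simp; ring
      · rw [coord_homothety, b.coord_apply]
        split_ifs with h
        · subst h; rw [hxp]; apply le_of_eq; field_simp; ring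
        · simpa using mul_nonneg (inv_nonneg.2 hc.le) (hx i)
    · refine b.ext_elem fun i => ?_
      rw [coord_homothety, coord_homothety]
      field_simp; ring
  · rintro ⟨y, hy, rfl⟩
    rw [mem_oppFace_iff] at hy
    refine ⟨fun i => ?_, ?_⟩
    · rw [coord_homothety, b.coord_apply]
      have := mul_nonneg hc.le (hy.2 i)
      split_ifs <;> linarith
    · rw [coord_homothety, b.coord_apply_eq, hy.1]; ring

omit [DecidableEq ι] in
theorem inner_sub_eq_coord_mul {ν : Pt N} {j : ι}
    (hν : ∀ i ≠ p, ⟪ν, b i - b j⟫ = 0) (y : Pt N) :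
    ⟪ν, y - b j⟫ = b.coord p y * ⟪ν, b p - b j⟫ := by
  have h := affineMap_eq_sum_coord b
    (((innerSL ℝ ν : Pt N →ₗ[ℝ] ℝ).toAffineMap).comp
      (AffineMap.id ℝ (Pt N) - AffineMap.const ℝ (Pt N) (b j))) y
  have h' : ⟪ν, y - b j⟫ = ∑ i, b.coord i y * ⟪ν, b i - b j⟫ := h
  rw [h', Finset.sum_eq_single p]
  · intro i _ hi
    rw [hν i hi, mul_zero]
  · simp

theorem surf_homothety_image (x : Pt N) {c : ℝ} (hc : 0 < c) (s : Set (Pt N)) :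
    surf N (AffineMap.homothety x c '' s) = ENNReal.ofReal (c ^ (N - 1)) * surf N s := by
  rw [surf, euclideanHausdorffMeasure_homothety_image _ _ hc.ne', ENNReal.smul_def, smul_eq_mul,
    ENNReal.ofReal_pow hc.le, ENNReal.coe_pow, Real.nnnorm_of_nonneg hc.le,
    ENNReal.ofReal_eq_coe_nnreal hc.le]

/-- The volume of a pyramid: the section at distance `x h` from the apex is the base scaled by
`x`. -/
theorem volume_simplex_eq (hN : 1 ≤ N) {ν : Pt N} (hν1 : ‖ν‖ = 1) {j : ι}
    (hν : ∀ i ≠ p, ⟪ν, b i - b j⟫ = 0) (hd : ⟪ν, b p - b j⟫ ≠ 0) :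
    volume (convexHull ℝ (range b)) =
      ENNReal.ofReal (|⟪ν, b p - b j⟫| / N) * surf N (oppFace b p) := by
  set d := ⟪ν, b p - b j⟫ with hd'
  -- The altitude, from the apex `b p` to the plane of the base.
  set v : Pt N := -d • ν with hv
  have hν0 : ν ≠ 0 := by
    rintro rfl; simp at hν1
  have hv0 : v ≠ 0 := smul_ne_zero (neg_ne_zero.2 hd) hν0
  have hvn : ‖v‖ₑ = ENNReal.ofReal |d| := by
    rw [← ofReal_norm, hv, norm_smul, hν1, mul_one, norm_neg, Real.norm_eq_abs]
  have hmem : ∀ (x : ℝ) (y : Pt N), y ∈ AffineSubspace.mk' (x • v +ᵥ b p) (ℝ ∙ v)ᗮ ↔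
      b.coord p y = 1 - x := by
    intro x y
    rw [AffineSubspace.mem_mk', Submodule.mem_orthogonal_singleton_iff_inner_right, vsub_eq_sub,
      vadd_eq_add]
    have e1 : y - (x • v + b p) = (y - b j) - (b p - b j) - x • v := by abel
    have e2 : ⟪v, y - (x • v + b p)⟫ = -(d * d) * (b.coord p y - (1 - x)) := by
      rw [e1, inner_sub_right, inner_sub_right, hv, real_inner_smul_left, real_inner_smul_left,
        inner_sub_eq_coord_mul b p hν, ← hd', real_inner_smul_left, real_inner_smul_right,
        real_inner_smul_right, real_inner_self_eq_norm_sq, hν1]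
      ring
    rw [e2, mul_eq_zero, or_iff_right (by simpa using hd), sub_eq_zero]
  have hvol : (volume : Measure (Pt N)) = μHE[finrank ℝ (Pt N)] :=
    InnerProductSpace.euclideanHausdorffMeasure_eq_volume.symm
  have hint : (fun x : ℝ => μHE[finrank ℝ (Pt N) - 1] (convexHull ℝ (range b) ∩
      (AffineSubspace.mk' (x • v +ᵥ b p) (ℝ ∙ v)ᗮ : Set (Pt N)))) =ᵐ[volume]
      (Ioc (0 : ℝ) 1).indicator
        fun x => ENNReal.ofReal (x ^ (N - 1)) * surf N (oppFace b p) := by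
    have h0 : ∀ᵐ x : ℝ, x ≠ 0 := by simp [ae_iff]
    filter_upwards [h0] with x hx0
    have hset : convexHull ℝ (range b) ∩
        (AffineSubspace.mk' (x • v +ᵥ b p) (ℝ ∙ v)ᗮ : Set (Pt N)) =
        {y ∈ convexHull ℝ (range b) | b.coord p y = 1 - x} := by
      ext y
      exact and_congr_right fun _ => hmem x y
    rw [hset, finrank_euclideanSpace_fin]
    by_cases hx : x ∈ Ioc (0 : ℝ) 1
    · rw [indicator_of_mem hx, simplex_section b p hx.1 hx.2]
      exact surf_homothety_image _ hx.1 _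
    · rw [indicator_of_notMem hx]
      convert measure_empty
      · rw [eq_empty_iff_forall_notMem]
        rintro y ⟨hy, hyp⟩
        rw [b.convexHull_eq_nonneg_coord] at hy
        have hy : ∀ i, 0 ≤ b.coord i y := hy
        have h1 : b.coord p y ≤ 1 := by
          rw [← b.sum_coord_apply_eq_one y]
          exact Finset.single_le_sum (f := fun i => b.coord i y) (fun i _ => hy i)
            (Finset.mem_univ p)
        have := hy p
        rw [hyp] at h1 this
        exact hx ⟨lt_of_le_of_ne (by linarith) hx0.symm, by linarith⟩
      · infer_instance
  rw [hvol, EuclideanGeometry.euclideanHausdorffMeasure_eq_lintegral (b p) hv0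
    (isCompact_simplex b).measurableSet, lintegral_congr_ae hint,
    lintegral_indicator measurableSet_Ioc, lintegral_mul_const _ (by fun_prop), hvn,
    ← ofReal_integral_eq_lintegral_ofReal, ← intervalIntegral.integral_of_le zero_le_one,
    integral_pow, ← mul_assoc, ← ENNReal.ofReal_mul (abs_nonneg _)]
  · congr 2
    rw [Nat.sub_add_cancel hN]
    have : ((N - 1 : ℕ) : ℝ) + 1 = N := by
      rw [Nat.cast_sub hN]; simp
    rw [this, one_pow, zero_pow (by omega)]
    ring
  · exact (continuous_pow _).integrableOn_Ioc
  · filter_upwards [ae_restrict_mem measurableSet_Ioc] with x hx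
    exact pow_nonneg hx.1.le _

omit [DecidableEq ι] in
include b in
theorem exists_ne_vertex (hN : 1 ≤ N) : ∃ j, j ≠ p := by
  have h := (b.ind.affineSpan_eq_top_iff_card_eq_finrank_add_one).1 b.tot
  rw [finrank_euclideanSpace_fin] at h
  have : 1 < Fintype.card ι := by omega
  have := Fintype.one_lt_card_iff_nontrivial.1 this
  exact exists_ne p

omit [DecidableEq ι] in
theorem exists_unit_normal (hN : 1 ≤ N) : ∃ (j : ι) (ν : Pt N), j ≠ p ∧ ‖ν‖ = 1 ∧
    (∀ i ≠ p, ⟪ν, b i - b j⟫ = 0) ∧ ⟪ν, b p - b j⟫ ≠ 0 := by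
  obtain ⟨j, hj⟩ := exists_ne_vertex b p hN
  set g := (InnerProductSpace.toDual ℝ (Pt N)).symm
    (LinearMap.toContinuousLinearMap (b.coord p).linear) with hg
  have hgi : ∀ x y, ⟪g, x - y⟫ = b.coord p x - b.coord p y := by
    intro x y
    rw [hg, InnerProductSpace.toDual_symm_apply]
    exact (b.coord p).linearMap_vsub x y
  have h1 : ⟪g, b p - b j⟫ = 1 := by
    rw [hgi, b.coord_apply_eq, b.coord_apply_ne hj.symm, sub_zero]
  have hg0 : g ≠ 0 := by
    intro h; rw [h, inner_zero_left] at h1; norm_num at h1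
  have hgn : ‖g‖ ≠ 0 := norm_ne_zero_iff.2 hg0
  refine ⟨j, ‖g‖⁻¹ • g, hj, ?_, fun i hi => ?_, ?_⟩
  · rw [norm_smul, norm_inv, norm_norm, inv_mul_cancel₀ hgn]
  · rw [real_inner_smul_left, hgi, b.coord_apply_ne hi.symm, b.coord_apply_ne hj.symm]; simp
  · rw [real_inner_smul_left, h1, mul_one]; exact inv_ne_zero hgn

omit [Fintype ι] [DecidableEq ι] in
theorem volume_simplex_pos : 0 < volume (convexHull ℝ (range b)) := by
  refine (isOpen_interior.measure_pos volume ?_).trans_le (measure_mono interior_subset)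
  rw [interior_convexHull_nonempty_iff_affineSpan_eq_top]
  exact b.tot

/-- A face has positive finite measure, since the pyramid over it has positive finite volume. -/
theorem surf_oppFace_ne_zero (hN : 1 ≤ N) : surf N (oppFace b p) ≠ 0 := by
  obtain ⟨j, ν, -, h1, h2, h3⟩ := exists_unit_normal b p hN
  intro h
  have := volume_simplex_eq b p hN h1 h2 h3
  rw [h, mul_zero] at this
  exact (volume_simplex_pos b).ne' this

theorem surf_oppFace_ne_top (hN : 1 ≤ N) : surf N (oppFace b p) ≠ ⊤ := by
  obtain ⟨j, ν, -, h1, h2, h3⟩ := exists_unit_normal b p hN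
  intro h
  have := volume_simplex_eq b p hN h1 h2 h3
  rw [h, ENNReal.mul_top] at this
  · exact (isCompact_simplex b).measure_ne_top this
  · rw [Ne, ENNReal.ofReal_eq_zero, not_le]
    have : (0 : ℝ) < N := by exact_mod_cast hN
    exact div_pos (abs_pos.2 h3) this

theorem surf_real_oppFace_pos (hN : 1 ≤ N) : 0 < (surf N).real (oppFace b p) :=
  ENNReal.toReal_pos (surf_oppFace_ne_zero b p hN) (surf_oppFace_ne_top b p hN)

theorem integrableOn_oppFace (hN : 1 ≤ N) {E : Type*} [NormedAddCommGroup E]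
    {f : Pt N → E} (hf : Continuous f) :
    IntegrableOn f (oppFace b p) (surf N) :=
  hf.continuousOn.integrableOn_of_subset_isCompact (isCompact_oppFace b p)
    (isCompact_oppFace b p).measurableSet Subset.rfl (surf_oppFace_ne_top b p hN)

/-- The mean of a barycentric coordinate over a face, by the layer cake formula: its superlevel
sets are scaled copies of the face. -/
theorem integral_coord_oppFace (hN : 1 ≤ N) {q : ι} (hq : q ≠ p) :
    ∫ x in oppFace b p, b.coord q x ∂(surf N) = (surf N).real (oppFace b p) / N := by
  have hcont : Continuous (b.coord q) := (b.coord q).continuous_of_finiteDimensional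
  have hmeas := (isCompact_oppFace b p).measurableSet
  have hnn : 0 ≤ᵐ[(surf N).restrict (oppFace b p)] fun x => b.coord q x := by
    filter_upwards [ae_restrict_mem hmeas] with x hx
    exact ((mem_oppFace_iff b p).1 hx).2 q
  rw [Integrable.integral_eq_integral_meas_le (integrableOn_oppFace b p hN hcont) hnn]
  have hset : ∀ t : ℝ, ((surf N).restrict (oppFace b p)).real {x | t ≤ b.coord q x} =
      (surf N).real {x ∈ oppFace b p | t ≤ b.coord q x} := by
    intro t
    rw [measureReal_restrict_apply (measurableSet_le measurable_const hcont.measurable), inter_comm]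
    rfl
  have hae : ∀ᵐ t : ℝ, t ∈ Ioi (0 : ℝ) →
      ((surf N).restrict (oppFace b p)).real {x | t ≤ b.coord q x} =
      (Ioc (0 : ℝ) 1).indicator (fun t => (1 - t) ^ (N - 1) * (surf N).real (oppFace b p)) t := by
    have h1 : ∀ᵐ t : ℝ, t ≠ 1 := by simp [ae_iff]
    filter_upwards [h1] with t ht1 ht0
    have ht0 : 0 < t := ht0
    rw [hset]
    rcases lt_or_gt_of_ne ht1 with ht | ht
    · rw [indicator_of_mem (show t ∈ Ioc (0 : ℝ) 1 from ⟨ht0, ht.le⟩)]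
      have := oppFace_section b p hq (c := 1 - t) (by linarith) (by linarith)
      rw [sub_sub_cancel] at this
      rw [this, measureReal_def, surf_homothety_image _ (by linarith), ENNReal.toReal_mul,
        ENNReal.toReal_ofReal (pow_nonneg (by linarith) _)]
      rfl
    · rw [indicator_of_notMem fun h => absurd h.2 (not_le.2 ht)]
      convert measureReal_empty
      · rw [eq_empty_iff_forall_notMem]
        rintro y ⟨hy, hyq⟩
        have hy := ((mem_oppFace_iff b p).1 hy).2
        have h1 : b.coord q y ≤ 1 := by
          rw [← b.sum_coord_apply_eq_one y]
          exact Finset.single_le_sum (f := fun i => b.coord i y) (fun i _ => hy i)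
            (Finset.mem_univ q)
        have hyq : t ≤ b.coord q y := hyq
        linarith
  rw [setIntegral_congr_ae measurableSet_Ioi hae, setIntegral_indicator measurableSet_Ioc,
    inter_eq_self_of_subset_right Ioc_subset_Ioi_self, integral_mul_const,
    ← intervalIntegral.integral_of_le zero_le_one,
    intervalIntegral.integral_comp_sub_left (fun t => t ^ (N - 1)) 1, sub_self, sub_zero,
    integral_pow, Nat.sub_add_cancel hN]
  have : ((N - 1 : ℕ) : ℝ) + 1 = N := by
    rw [Nat.cast_sub hN]; simp
  rw [this, one_pow, zero_pow (by omega)]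
  ring

theorem integral_affineMap_oppFace (hN : 1 ≤ N) (l : Pt N →ᵃ[ℝ] ℝ) :
    ∫ x in oppFace b p, l x ∂(surf N) =
      (surf N).real (oppFace b p) / N * ∑ i ∈ Finset.univ.erase p, l (b i) := by
  have h1 : ∫ x in oppFace b p, l x ∂(surf N) =
      ∫ x in oppFace b p, ∑ i ∈ Finset.univ.erase p, b.coord i x * l (b i) ∂(surf N) := by
    refine setIntegral_congr_fun (isCompact_oppFace b p).measurableSet fun x hx => ?_
    rw [affineMap_eq_sum_coord b l x, Finset.sum_erase]
    rw [((mem_oppFace_iff b p).1 hx).1, zero_mul]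
  rw [h1, integral_finsetSum, Finset.mul_sum]
  · refine Finset.sum_congr rfl fun i hi => ?_
    rw [integral_mul_const, integral_coord_oppFace b p hN (Finset.ne_of_mem_erase hi)]
  · intro i _
    exact integrableOn_oppFace b p hN
      ((b.coord i).continuous_of_finiteDimensional.mul continuous_const)

/-- Every point of a face is contained in arbitrarily small scaled copies of the face, which have
positive measure. -/
theorem eq_zero_of_integral_oppFace_eq_zero (hN : 1 ≤ N) {f : Pt N → ℝ} (hf : Continuous f)
    (hnn : ∀ x, 0 ≤ f x) (hint : ∫ x in oppFace b p, f x ∂(surf N) = 0) {x : Pt N}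
    (hx : x ∈ oppFace b p) : f x = 0 := by
  by_contra hne
  have hae := (setIntegral_eq_zero_iff_of_nonneg_ae (Eventually.of_forall hnn)
    (integrableOn_oppFace b p hN hf)).1 hint
  obtain ⟨r, hr⟩ := (isCompact_oppFace b p).isBounded.subset_closedBall x
  have hev : ∀ᶠ y in 𝓝 x, f y ≠ 0 := hf.continuousAt.eventually_ne hne
  obtain ⟨δ, hδ, hball⟩ := Metric.eventually_nhds_iff.1 hev
  have hr0 : 0 ≤ r := by simpa using hr hx
  set c : ℝ := min 1 (δ / (2 * (r + 1)))
  have hc0 : 0 < c := lt_min one_pos (by positivity)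
  have hsub : AffineMap.homothety x c '' oppFace b p ⊆ {y | ¬ f y = 0} ∩ oppFace b p := by
    rintro _ ⟨y, hy, rfl⟩
    refine ⟨hball ?_, ?_⟩
    · rw [AffineMap.homothety_eq_lineMap, dist_lineMap_left, Real.norm_of_nonneg hc0.le]
      have h1 : dist x y ≤ r := by rw [dist_comm]; exact hr hy
      have h2 : c ≤ δ / (2 * (r + 1)) := min_le_right _ _
      calc c * dist x y ≤ δ / (2 * (r + 1)) * r := by gcongr
        _ < δ := by
          rw [div_mul_eq_mul_div, div_lt_iff₀ (by positivity)]
          nlinarith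
    · rw [AffineMap.homothety_eq_lineMap]
      exact (convex_convexHull ℝ _).lineMap_mem hx hy ⟨hc0.le, min_le_left _ _⟩
  have h0 : surf N ({y | ¬ f y = 0} ∩ oppFace b p) = 0 := by
    have := ae_iff.1 hae
    rwa [Measure.restrict_apply] at this
    exact (isOpen_ne_fun hf continuous_const).measurableSet
  have h1 := measure_mono_null hsub h0
  rw [surf_homothety_image _ hc0, mul_eq_zero, ENNReal.ofReal_eq_zero] at h1
  exact h1.elim (not_le.2 (pow_pos hc0 _)) (surf_oppFace_ne_zero b p hN)

/-- The flux of an affine field through the face opposite to `b p`, out of the simplex. The outer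
unit normal is encoded as the multiple `- N |E| / |F| ∇ λ_p` of the gradient of the barycentric
coordinate of `b p`. -/
def flux (u : Pt N →ᵃ[ℝ] Pt N) : ℝ :=
  -(N * volume.real (convexHull ℝ (range b)) / (surf N).real (oppFace b p)) *
    ∫ x in oppFace b p, (b.coord p).linear (u x) ∂(surf N)

theorem flux_eq_sum (hN : 1 ≤ N) (u : Pt N →ᵃ[ℝ] Pt N) :
    flux b p u = -volume.real (convexHull ℝ (range b)) *
      ∑ i ∈ Finset.univ.erase p, (b.coord p).linear (u (b i)) := by
  have h := integral_affineMap_oppFace b p hN ((b.coord p).linear.toAffineMap.comp u)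
  simp only [AffineMap.comp_apply, LinearMap.coe_toAffineMap] at h
  rw [flux, h]
  have h1 := (surf_real_oppFace_pos b p hN).ne'
  have h2 : (N : ℝ) ≠ 0 := by exact_mod_cast (by omega : N ≠ 0)
  field_simp

theorem sum_coord_linear (w : Pt N) : ∑ i, (b.coord i).linear w = 0 := by
  have h : ∀ i, (b.coord i).linear w = b.coord i w - b.coord i 0 := by
    intro i
    have := (b.coord i).linearMap_vsub w 0
    simpa using this
  simp_rw [h]
  rw [Finset.sum_sub_distrib, b.sum_coord_apply_eq_one, b.sum_coord_apply_eq_one, sub_self]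

theorem sum_coord_linear_smul (w : Pt N) : ∑ i, (b.coord i).linear w • b i = w := by
  have h : ∀ i, (b.coord i).linear w = b.coord i w - b.coord i 0 := by
    intro i
    have := (b.coord i).linearMap_vsub w 0
    simpa using this
  simp_rw [h, sub_smul]
  rw [Finset.sum_sub_distrib, b.linear_combination_coord_eq_self,
    b.linear_combination_coord_eq_self, sub_zero]

theorem sum_coord_linear_eq_divg (u : Pt N →ᵃ[ℝ] Pt N) :
    ∑ p, (b.coord p).linear (u (b p)) = divg u := by
  have hu : ∀ x, u x = u.linear x + u 0 := fun x => by
    have := u.linearMap_vsub x 0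
    simp only [vsub_eq_sub, sub_zero] at this
    rw [this]; abel
  have hcoord : ∀ (l : Pt N →ₗ[ℝ] ℝ) (x : Pt N), l x = ∑ i, x i * l (EuclideanSpace.single i 1) := by
    intro l x
    conv_lhs => rw [← (EuclideanSpace.basisFun (Fin N) ℝ).sum_repr x, map_sum]
    refine Finset.sum_congr rfl fun i _ => ?_
    rw [map_smul, EuclideanSpace.basisFun_repr, EuclideanSpace.basisFun_apply, smul_eq_mul]
  simp_rw [fun p => hu (b p), map_add, Finset.sum_add_distrib, sum_coord_linear, add_zero]
  simp_rw [divg, pderiv]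
  have h1 : ∀ i, u.linear (EuclideanSpace.single i 1) i =
      ∑ p, (b.coord p).linear (EuclideanSpace.single i 1) * u.linear (b p) i := by
    intro i
    conv_lhs => rw [← sum_coord_linear_smul b (EuclideanSpace.single i 1), map_sum]
    simp [map_smul]
  simp_rw [h1]
  rw [Finset.sum_comm]
  refine Finset.sum_congr rfl fun p _ => ?_
  rw [hcoord (b.coord p).linear (u.linear (b p))]
  exact Finset.sum_congr rfl fun i _ => mul_comm _ _

/-- The divergence theorem for affine fields on a simplex. -/
theorem sum_flux (hN : 1 ≤ N) (u : Pt N →ᵃ[ℝ] Pt N) :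
    ∑ p, flux b p u = volume.real (convexHull ℝ (range b)) * divg u := by
  have h : ∀ p, flux b p u = volume.real (convexHull ℝ (range b)) *
      ((b.coord p).linear (u (b p)) - ∑ i, (b.coord p).linear (u (b i))) := by
    intro p
    rw [flux_eq_sum b p hN, ← Finset.add_sum_erase _ _ (Finset.mem_univ p)]
    ring
  simp_rw [h]
  rw [← Finset.mul_sum, Finset.sum_sub_distrib, sum_coord_linear_eq_divg, Finset.sum_comm]
  simp_rw [sum_coord_linear]
  simp

/-- The identification of `flux` with the integral of the normal component, for a unit normal `ν` of
either orientation: the prefactor is `1` if `ν` points out of the simplex and `-1` otherwise. -/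
theorem flux_eq_integral_inner (hN : 1 ≤ N) {ν : Pt N} (hν1 : ‖ν‖ = 1) {j : ι} (hj : j ≠ p)
    (hν : ∀ i ≠ p, ⟪ν, b i - b j⟫ = 0) (hd : ⟪ν, b p - b j⟫ ≠ 0) (u : Pt N →ᵃ[ℝ] Pt N) :
    flux b p u = -(|⟪ν, b p - b j⟫| / ⟪ν, b p - b j⟫) *
      ∫ x in oppFace b p, ⟪u x, ν⟫ ∂(surf N) := by
  set d := ⟪ν, b p - b j⟫ with hd'
  have hlin : ∀ w, (b.coord p).linear w = ⟪w, ν⟫ / d := by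
    intro w
    have h1 := inner_sub_eq_coord_mul b p hν (w + b j)
    have h2 := (b.coord p).map_vadd (b j) w
    rw [vadd_eq_add, b.coord_apply_ne hj.symm, vadd_eq_add, add_zero] at h2
    rw [h2, add_sub_cancel_right, ← hd'] at h1
    rw [real_inner_comm, h1, mul_div_cancel_right₀ _ hd]
  have hvol : volume.real (convexHull ℝ (range b)) = |d| / N * (surf N).real (oppFace b p) := by
    rw [measureReal_def, volume_simplex_eq b p hN hν1 hν hd, ENNReal.toReal_mul,
      ENNReal.toReal_ofReal (by positivity)]
    rfl
  have h1 := (surf_real_oppFace_pos b p hN).ne'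
  have h2 : (N : ℝ) ≠ 0 := by exact_mod_cast (by omega : N ≠ 0)
  simp_rw [flux, hlin]
  rw [integral_div, hvol]
  field_simp

theorem flux_eq_zero (hN : 1 ≤ N) {u : Pt N →ᵃ[ℝ] Pt N}
    (hu : ∫ x in oppFace b p, u x ∂(surf N) = 0) : flux b p u = 0 := by
  have h : ∫ x in oppFace b p, (b.coord p).linear (u x) ∂(surf N) = 0 := by
    have := (LinearMap.toContinuousLinearMap (b.coord p).linear).integral_comp_comm
      (integrableOn_oppFace b p hN u.continuous_of_finiteDimensional)
    rw [hu, map_zero] at this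
    exact this
  rw [flux, h, mul_zero]

end Simplex

/-! ### Faces of a mesh and discrete integration by parts -/

namespace Mesh

variable {N : ℕ} {Ω : Set (Pt N)} {T : Mesh N Ω}

/-- The vertices of an element form an affine basis of `ℝ^N`. -/
def Elem.basis (E : T.Elem) : AffineBasis E.1 ℝ (Pt N) where
  toFun := (↑)
  ind' := T.indep E.2.1
  tot' := by
    refine ((T.indep E.2.1).affineSpan_eq_top_iff_card_eq_finrank_add_one).2 ?_
    rw [finrank_euclideanSpace_fin, Fintype.card_coe, E.2.2]

theorem Elem.basis_apply (E : T.Elem) (p : E.1) : E.basis p = p := rfl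

theorem Elem.convexHull_range_basis (E : T.Elem) : convexHull ℝ (range E.basis) = E.carrier := by
  have : range E.basis = (E.1 : Set (Pt N)) := Subtype.range_coe
  rw [this]; rfl

theorem Elem.oppFace_basis [DecidableEq (Pt N)] (E : T.Elem) (p : E.1) :
    oppFace E.basis p = simplex (E.1.erase p) := by
  rw [oppFace, simplex]
  congr 1
  ext x
  constructor
  · rintro ⟨q, hq, rfl⟩
    exact Finset.mem_erase.2 ⟨fun h => hq (Subtype.ext h), q.2⟩
  · intro hx
    obtain ⟨h1, h2⟩ := Finset.mem_erase.1 hx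
    exact ⟨⟨x, h2⟩, fun h => h1 (congrArg Subtype.val h), rfl⟩

theorem Elem.exists_eq_erase [DecidableEq (Pt N)] (E : T.Elem) {F : Finset (Pt N)}
    (hF : F.card = N) (hFE : F ⊆ E.1) : ∃ p : E.1, F = E.1.erase p := by
  have h1 : (E.1 \ F).card = 1 := by
    rw [Finset.card_sdiff_of_subset hFE, hF, E.2.2]; omega
  obtain ⟨p, hp⟩ := Finset.card_eq_one.1 h1
  have hpE : p ∈ E.1 \ F := by rw [hp]; exact Finset.mem_singleton_self p
  refine ⟨⟨p, (Finset.mem_sdiff.1 hpE).1⟩, ?_⟩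
  rw [Finset.erase_eq, ← hp, Finset.sdiff_sdiff_eq_self hFE]

theorem Elem.volume_real_pos (E : T.Elem) : 0 < volume.real E.carrier := by
  rw [← E.convexHull_range_basis]
  exact ENNReal.toReal_pos (volume_simplex_pos _).ne' (isCompact_simplex _).measure_ne_top

/-- Two elements that lie on the same side of a common face coincide: near the centroid of the face
they overlap outside of it. -/
theorem Elem.eq_of_same_side {E E' : T.Elem} {F : Finset (Pt N)} (hF : F.card = N)
    (hFE : F ⊆ E.1) (hFE' : F ⊆ E'.1) {ν : Pt N} (hν : ∀ x ∈ F, ∀ y ∈ F, ⟪ν, x - y⟫ = 0)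
    {p p' x : Pt N} (hp : p ∈ E.1) (hp' : p' ∈ E'.1) (hpF' : p' ∉ F) (hx : x ∈ F)
    (hside : 0 < ⟪ν, p - x⟫ * ⟪ν, p' - x⟫) : E = E' := by
  classical
  by_contra hne
  have hinter : E.1 ∩ E'.1 = F := by
    refine (Finset.eq_of_subset_of_card_le (Finset.subset_inter hFE hFE') ?_).symm
    rw [hF]
    by_contra hcard
    have h1 : E.1 ∩ E'.1 = E.1 :=
      Finset.eq_of_subset_of_card_le Finset.inter_subset_left (by rw [E.2.2]; omega)
    have h2 : E.1 ∩ E'.1 = E'.1 :=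
      Finset.eq_of_subset_of_card_le Finset.inter_subset_right (by rw [E'.2.2]; omega)
    exact hne (Subtype.ext (h1.symm.trans h2))
  obtain ⟨q, hq⟩ := E'.exists_eq_erase hF hFE'
  have hqp : (q : Pt N) = p' := by
    by_contra h
    exact hpF' (hq ▸ Finset.mem_erase.2 ⟨fun h' => h h'.symm, hp'⟩)
  set b := E'.basis with hb
  have hface : oppFace b q = simplex F := by rw [hb, Elem.oppFace_basis, ← hq]
  set j : E'.1 := ⟨x, hFE' hx⟩
  have hνb : ∀ i ≠ q, ⟪ν, b i - b j⟫ = 0 := by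
    intro i hi
    refine hν _ ?_ _ hx
    rw [hq]
    exact Finset.mem_erase.2 ⟨fun h => hi (Subtype.ext h), i.2⟩
  have hinner : ∀ y, ⟪ν, y - x⟫ = b.coord q y * ⟪ν, p' - x⟫ := by
    intro y
    have := inner_sub_eq_coord_mul b q hνb y
    rwa [hb, Elem.basis_apply, Elem.basis_apply, hqp] at this
  have hjq : j ≠ q := by
    intro h
    apply hpF'
    rw [← hqp, ← h]
    exact hx
  have hcoord : 0 < b.coord q p := by
    rw [hinner p] at hside
    have : 0 < b.coord q p * (⟪ν, p' - x⟫ * ⟪ν, p' - x⟫) := by linarith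
    exact pos_of_mul_pos_left this (mul_self_nonneg _)
  -- The centroid of the common face.
  set s : Finset E'.1 := Finset.univ.erase q
  have hsne : s.Nonempty := ⟨j, Finset.mem_erase.2 ⟨hjq, Finset.mem_univ _⟩⟩
  set β := s.centroid ℝ b with hβ
  have hβi : ∀ i ≠ q, 0 < b.coord i β := by
    intro i hi
    rw [hβ, b.coord_apply_centroid (Finset.mem_erase.2 ⟨hi, Finset.mem_univ _⟩)]
    exact inv_pos.2 (Nat.cast_pos.2 hsne.card_pos)
  have hβq : b.coord q β = 0 := by
    rw [hβ, Finset.centroid_def, b.coord_apply_combination_of_notMem (Finset.notMem_erase _ _)]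
    exact Finset.sum_centroidWeights_eq_one_of_nonempty ℝ s hsne
  have hβF : β ∈ simplex F := by
    rw [← hface, mem_oppFace_iff]
    refine ⟨hβq, fun i => ?_⟩
    rcases eq_or_ne i q with rfl | hi
    · exact hβq.ge
    · exact (hβi i hi).le
  have hev : ∀ᶠ δ in 𝓝[>] (0 : ℝ), ∀ i, 0 ≤ b.coord i (AffineMap.lineMap β p δ) := by
    rw [eventually_all]
    intro i
    have hlin : ∀ δ : ℝ, b.coord i (AffineMap.lineMap β p δ) =
        (1 - δ) * b.coord i β + δ * b.coord i p := fun δ => by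
      rw [AffineMap.apply_lineMap, AffineMap.lineMap_apply_ring]
    simp only [hlin]
    rcases eq_or_ne i q with rfl | hi
    · filter_upwards [self_mem_nhdsWithin] with δ hδ
      have hδ : 0 < δ := hδ
      rw [hβq, mul_zero, zero_add]
      positivity
    · have : Continuous fun δ : ℝ => (1 - δ) * b.coord i β + δ * b.coord i p := by fun_prop
      have h0 : ∀ᶠ δ in 𝓝 (0 : ℝ), 0 < (1 - δ) * b.coord i β + δ * b.coord i p :=
        this.continuousAt.eventually (lt_mem_nhds (by simpa using hβi i hi))
      filter_upwards [nhdsWithin_le_nhds h0] with δ hδ using hδ.le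
  have h1 : ∀ᶠ δ in 𝓝[>] (0 : ℝ), δ < 1 := nhdsWithin_le_nhds (gt_mem_nhds one_pos)
  obtain ⟨δ, ⟨hδ, hδ1⟩, hδ0⟩ := ((hev.and h1).and self_mem_nhdsWithin).exists
  have hδ0 : 0 < δ := hδ0
  set y : Pt N := AffineMap.lineMap β p δ with hy
  have hyE : y ∈ convexHull ℝ (E.1 : Set (Pt N)) :=
    (convex_convexHull ℝ _).lineMap_mem (convexHull_mono (by exact_mod_cast hFE) hβF)
      (subset_convexHull ℝ _ hp) ⟨hδ0.le, hδ1.le⟩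
  have hyE' : y ∈ convexHull ℝ (E'.1 : Set (Pt N)) := by
    have : y ∈ convexHull ℝ (range b) := by
      rw [b.convexHull_eq_nonneg_coord]; exact hδ
    rwa [hb, Elem.convexHull_range_basis] at this
  have hyF := T.inter_subset_convexHull E.2.1 E'.2.1 ⟨hyE, hyE'⟩
  rw [← Finset.coe_inter, hinter] at hyF
  have hyF : y ∈ oppFace b q := by rw [hface]; exact hyF
  have h0 := ((mem_oppFace_iff b q).1 hyF).1
  rw [hy, AffineMap.apply_lineMap, AffineMap.lineMap_apply_ring, hβq, mul_zero, zero_add] at h0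
  exact (mul_pos hδ0 hcoord).ne' h0

variable (o : T.Orientation)

theorem Orientation.exists_vertex_minus [DecidableEq (Pt N)] (F : T.InnerFace) :
    ∃ p : (o.minus F).1, F.1.1 = (o.minus F).1.erase p :=
  (o.minus F).exists_eq_erase F.1.2.2 (o.subset_minus F)

theorem Orientation.exists_vertex_plus [DecidableEq (Pt N)] (F : T.InnerFace) :
    ∃ p : (o.plus F).1, F.1.1 = (o.plus F).1.erase p :=
  (o.plus F).exists_eq_erase F.1.2.2 (o.subset_plus F)

theorem InnerFace.nonempty (hN : 1 ≤ N) (F : T.InnerFace) : F.1.1.Nonempty := by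
  rw [← Finset.card_pos, F.1.2.2]; omega

theorem Orientation.minus_ne_plus (hN : 1 ≤ N) (F : T.InnerFace) : o.minus F ≠ o.plus F := by
  classical
  intro h
  obtain ⟨p, hp⟩ := o.exists_vertex_minus F
  obtain ⟨x, hx⟩ := F.nonempty hN
  have hpF : (p : Pt N) ∉ F.1.1 := by rw [hp]; exact Finset.notMem_erase _ _
  have h1 := o.minus_side F p p.2 hpF x hx
  have h2 := o.plus_side F p (h ▸ p.2) hpF x hx
  linarith

theorem Orientation.eq_minus_or_eq_plus (hN : 1 ≤ N) (F : T.InnerFace) {E : T.Elem}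
    (hFE : F.1.1 ⊆ E.1) : E = o.minus F ∨ E = o.plus F := by
  classical
  obtain ⟨x, hx⟩ := F.nonempty hN
  obtain ⟨p, hp⟩ := E.exists_eq_erase F.1.2.2 hFE
  obtain ⟨q, hq⟩ := o.exists_vertex_minus F
  obtain ⟨r, hr⟩ := o.exists_vertex_plus F
  have hpF : (p : Pt N) ∉ F.1.1 := by rw [hp]; exact Finset.notMem_erase _ _
  have hqF : (q : Pt N) ∉ F.1.1 := by rw [hq]; exact Finset.notMem_erase _ _
  have hrF : (r : Pt N) ∉ F.1.1 := by rw [hr]; exact Finset.notMem_erase _ _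
  have h1 := o.minus_side F q q.2 hqF x hx
  have h2 := o.plus_side F r r.2 hrF x hx
  have hν : ∀ x ∈ F.1.1, ∀ y ∈ F.1.1, ⟪o.normal F, x - y⟫ = 0 := o.normal_orthogonal F
  have hp0 : ⟪o.normal F, (p : Pt N) - x⟫ ≠ 0 := by
    intro h0
    set j : E.1 := ⟨x, hFE hx⟩
    have hνb : ∀ i ≠ p, ⟪o.normal F, E.basis i - E.basis j⟫ = 0 := by
      intro i hi
      refine hν _ ?_ _ hx
      rw [hp]
      exact Finset.mem_erase.2 ⟨fun h => hi (Subtype.ext h), i.2⟩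
    have hall : ∀ y, ⟪o.normal F, y - x⟫ = 0 := by
      intro y
      have := inner_sub_eq_coord_mul E.basis p hνb y
      rw [Elem.basis_apply, Elem.basis_apply, h0, mul_zero] at this
      exact this
    exact h1.ne (hall q)
  rcases lt_or_gt_of_ne hp0 with h | h
  · left
    exact Elem.eq_of_same_side F.1.2.2 hFE (o.subset_minus F) hν p.2 q.2 hqF hx
      (mul_pos_of_neg_of_neg h h1)
  · right
    exact Elem.eq_of_same_side F.1.2.2 hFE (o.subset_plus F) hν p.2 r.2 hrF hx (mul_pos h h2)

theorem InnerFace.carrier_eq_oppFace [DecidableEq (Pt N)] {F : T.InnerFace} {E : T.Elem} {p : E.1}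
    (hp : F.1.1 = E.1.erase p) : F.carrier = oppFace E.basis p := by
  rw [Elem.oppFace_basis, InnerFace.carrier, hp]

theorem InnerFace.carrier_eq_oppFace_minus (F : T.InnerFace) :
    ∃ p : (o.minus F).1, F.carrier = oppFace (o.minus F).basis p := by
  classical
  obtain ⟨p, hp⟩ := o.exists_vertex_minus F
  exact ⟨p, InnerFace.carrier_eq_oppFace hp⟩

include o in
theorem InnerFace.integrableOn (hN : 1 ≤ N) (F : T.InnerFace) {X : Type*} [NormedAddCommGroup X]
    {f : Pt N → X} (hf : Continuous f) : IntegrableOn f F.carrier (surf N) := by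
  classical
  obtain ⟨p, hp⟩ := F.carrier_eq_oppFace_minus o
  rw [hp]
  exact integrableOn_oppFace _ p hN hf

include o in
theorem InnerFace.surf_real_pos (hN : 1 ≤ N) (F : T.InnerFace) :
    0 < (surf N).real F.carrier := by
  classical
  obtain ⟨p, hp⟩ := F.carrier_eq_oppFace_minus o
  rw [hp]
  exact surf_real_oppFace_pos _ p hN

/-- The flux of `u` out of `E` through an inner face, expressed by the normal of the face. -/
theorem Orientation.flux_eq (hN : 1 ≤ N) {F : T.InnerFace} {E : T.Elem} [DecidableEq (Pt N)]
    {p : E.1} (hp : F.1.1 = E.1.erase p) {x : Pt N} (hx : x ∈ F.1.1)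
    (hd : ⟪o.normal F, (p : Pt N) - x⟫ ≠ 0) (u : Pt N →ᵃ[ℝ] Pt N) :
    flux E.basis p u = -(|⟪o.normal F, (p : Pt N) - x⟫| / ⟪o.normal F, (p : Pt N) - x⟫) *
      ∫ x in F.carrier, ⟪u x, o.normal F⟫ ∂(surf N) := by
  have hxE : x ∈ E.1.erase p := hp ▸ hx
  have := flux_eq_integral_inner E.basis p hN (o.norm_normal F)
    (j := ⟨x, Finset.mem_of_mem_erase hxE⟩)
    (fun h => Finset.ne_of_mem_erase hxE (congrArg Subtype.val h)) (fun i hi => ?_) hd u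
  · rw [this, InnerFace.carrier_eq_oppFace hp]
    rfl
  · refine o.normal_orthogonal F _ ?_ _ hx
    rw [hp]
    exact Finset.mem_erase.2 ⟨fun h => hi (Subtype.ext h), i.2⟩

/-- Discrete integration by parts: only the jumps over the inner faces contribute, provided that
the means over the boundary faces vanish. -/
theorem Orientation.sum_volume_mul_divg (hN : 1 ≤ N) {w : PwAffine T}
    (hw : ∀ F : T.Face, simplex F.1 ⊆ frontier Ω → ∀ E : T.Elem, F.1 ⊆ E.1 →
      ∫ x in simplex F.1, w E x ∂(surf N) = 0) :
    ∑ E : T.Elem, volume.real E.carrier * divg (w E) =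
      ∑ F : T.InnerFace, ((∫ x in F.carrier, ⟪w (o.minus F) x, o.normal F⟫ ∂(surf N)) -
        ∫ x in F.carrier, ⟪w (o.plus F) x, o.normal F⟫ ∂(surf N)) := by
  classical
  have key : ∀ E : T.Elem, volume.real E.carrier * divg (w E) =
      ∑ F : T.InnerFace, ((if E = o.minus F then
          ∫ x in F.carrier, ⟪w E x, o.normal F⟫ ∂(surf N) else 0) -
        if E = o.plus F then ∫ x in F.carrier, ⟪w E x, o.normal F⟫ ∂(surf N) else 0) := by
    intro E
    rw [← E.convexHull_range_basis, ← sum_flux E.basis hN]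
    have h1 : ∀ p : E.1, flux E.basis p (w E) =
        ∑ F : T.InnerFace, if F.1.1 = E.1.erase p then flux E.basis p (w E) else 0 := by
      intro p
      have hcard : (E.1.erase p).card = N := by
        rw [Finset.card_erase_of_mem p.2, E.2.2]; rfl
      have hface : E.1.erase p ∈ T.faces := by
        refine T.down_closed E.2.1 (Finset.erase_subset _ _) ?_
        rw [← Finset.card_pos, hcard]; omega
      by_cases hb : simplex (E.1.erase p) ⊆ frontier Ω
      · have h0 : flux E.basis p (w E) = 0 := by
          refine flux_eq_zero _ p hN ?_
          rw [Elem.oppFace_basis]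
          exact hw ⟨_, hface, hcard⟩ hb E (Finset.erase_subset _ _)
        rw [h0]; simp
      · set F₀ : T.InnerFace := ⟨⟨_, hface, hcard⟩, hb⟩
        rw [Finset.sum_eq_single F₀]
        · rw [if_pos rfl]
        · intro F _ hF
          rw [if_neg fun h => hF (Subtype.ext (Subtype.ext h))]
        · simp
    rw [Finset.sum_congr rfl fun p _ => h1 p, Finset.sum_comm]
    refine Finset.sum_congr rfl fun F _ => ?_
    obtain ⟨x, hx⟩ := F.nonempty hN
    by_cases hFE : F.1.1 ⊆ E.1
    · obtain ⟨p, hp⟩ := E.exists_eq_erase F.1.2.2 hFE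
      have hpF : (p : Pt N) ∉ F.1.1 := by rw [hp]; exact Finset.notMem_erase _ _
      rw [Finset.sum_eq_single p]
      · rw [if_pos hp]
        rcases o.eq_minus_or_eq_plus hN F hFE with hE | hE
        · rw [if_pos hE, if_neg fun h => o.minus_ne_plus hN F (hE.symm.trans h)]
          have hd := o.minus_side F p (hE ▸ p.2) hpF x hx
          rw [o.flux_eq hN hp hx hd.ne, abs_of_neg hd, neg_div, div_self hd.ne]
          ring
        · rw [if_pos hE, if_neg fun h => o.minus_ne_plus hN F (h.symm.trans hE)]
          have hd := o.plus_side F p (hE ▸ p.2) hpF x hx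
          rw [o.flux_eq hN hp hx hd.ne', abs_of_pos hd, div_self hd.ne']
          ring
      · intro q _ hq
        refine if_neg fun h => hq (Subtype.ext ?_)
        by_contra hne
        have hq' : (q : Pt N) ∈ E.1.erase p := Finset.mem_erase.2 ⟨hne, q.2⟩
        rw [← hp, h] at hq'
        exact Finset.notMem_erase _ _ hq'
      · simp
    · have hm : E ≠ o.minus F := fun h => hFE (h ▸ o.subset_minus F)
      have hp : E ≠ o.plus F := fun h => hFE (h ▸ o.subset_plus F)
      rw [if_neg hm, if_neg hp, sub_zero]
      refine Finset.sum_eq_zero fun p _ => if_neg fun h => hFE ?_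
      rw [h]; exact Finset.erase_subset _ _
  simp_rw [key]
  rw [Finset.sum_comm]
  refine Finset.sum_congr rfl fun F _ => ?_
  rw [Finset.sum_sub_distrib]
  congr 1
  · rw [Finset.sum_ite_eq' Finset.univ (o.minus F)
      fun E => ∫ x in F.carrier, ⟪w E x, o.normal F⟫ ∂(surf N), if_pos (Finset.mem_univ _)]
  · rw [Finset.sum_ite_eq' Finset.univ (o.plus F)
      fun E => ∫ x in F.carrier, ⟪w E x, o.normal F⟫ ∂(surf N), if_pos (Finset.mem_univ _)]

end Mesh

/-! ### Definiteness of curl, divergence and jumps -/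

section LinearAlgebra

variable {N : ℕ}

theorem linear_apply_eq_sum (D : Pt N →ₗ[ℝ] Pt N) (x : Pt N) (j : Fin N) :
    D x j = ∑ i, x i * D (EuclideanSpace.single i 1) j := by
  conv_lhs => rw [← (EuclideanSpace.basisFun (Fin N) ℝ).sum_repr x, map_sum]
  simp [map_smul]

/-- A field without curl has a symmetric gradient. -/
theorem isSymmetric_of_forall_apply_single {D : Pt N →ₗ[ℝ] Pt N}
    (hD : ∀ i j, D (EuclideanSpace.single i 1) j = D (EuclideanSpace.single j 1) i) :
    D.IsSymmetric := by
  intro x y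
  simp only [PiLp.inner_apply, RCLike.inner_apply, conj_trivial]
  simp_rw [linear_apply_eq_sum D x, linear_apply_eq_sum D y, Finset.mul_sum, Finset.sum_mul]
  rw [Finset.sum_comm]
  refine Finset.sum_congr rfl fun i _ => Finset.sum_congr rfl fun j _ => ?_
  rw [hD i j]; ring

/-- A symmetric rank-one map without trace vanishes. -/
theorem eq_zero_of_isSymmetric_of_orthogonal {D : Pt N →ₗ[ℝ] Pt N} (hD : D.IsSymmetric)
    (htr : ∑ i, D (EuclideanSpace.single i 1) i = 0) {ν : Pt N} (hν : ‖ν‖ = 1)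
    (hker : ∀ τ, ⟪ν, τ⟫ = 0 → D τ = 0) : D = 0 := by
  have h1 : ∀ x, D x = ⟪ν, x⟫ • D ν := by
    intro x
    have : D (x - ⟪ν, x⟫ • ν) = 0 := by
      apply hker
      rw [inner_sub_right, real_inner_smul_right, real_inner_self_eq_norm_sq, hν]; ring
    rwa [map_sub, map_smul, sub_eq_zero] at this
  have h2 : ⟪D ν, ν⟫ = 0 := by
    rw [← htr, PiLp.inner_apply]
    refine Finset.sum_congr rfl fun i _ => ?_
    rw [h1 (EuclideanSpace.single i 1)]
    simp [EuclideanSpace.inner_single_right]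
  have h3 : D ν = 0 := by
    rw [← inner_self_eq_zero (𝕜 := ℝ), hD, h1 (D ν), real_inner_smul_right]
    rw [real_inner_comm] at h2
    rw [h2, zero_mul]
  ext1 x
  rw [h1, h3, smul_zero, LinearMap.zero_apply]

/-- A vector without normal and tangential part vanishes. -/
theorem eq_zero_of_inner_of_cross {a n : Pt N} (hn : ‖n‖ = 1) (h1 : ⟪a, n⟫ = 0)
    (h2 : ∀ i j, i < j → cross a n i j = 0) : a = 0 := by
  have h3 : ∀ i j, a i * n j = a j * n i := by
    intro i j
    rcases lt_trichotomy i j with h | rfl | h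
    · have := h2 i j h; unfold cross at this; linarith
    · rfl
    · have := h2 j i h; unfold cross at this; linarith
  have hsq : ∑ j, n j * n j = 1 := by
    have : ⟪n, n⟫ = 1 := by rw [real_inner_self_eq_norm_sq, hn]; norm_num
    rw [PiLp.inner_apply] at this
    simpa [← sq] using this
  have hin : ∑ j, a j * n j = 0 := by
    rw [PiLp.inner_apply] at h1
    simpa [mul_comm] using h1
  ext i
  calc a i = ∑ j, a i * n j * n j := by simp_rw [mul_assoc]; rw [← Finset.mul_sum, hsq, mul_one]
    _ = ∑ j, a j * n j * n i := Finset.sum_congr rfl fun j _ => by rw [h3 i j]; ring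
    _ = 0 := by rw [← Finset.sum_mul, hin, zero_mul]

theorem skewDot_self_eq_sum (A : Fin N → Fin N → ℝ) :
    skewDot A A = ∑ i, ∑ j, if i < j then A i j ^ 2 else 0 := by
  simp_rw [skewDot, sq]

theorem skewDot_self_nonneg (A : Fin N → Fin N → ℝ) : 0 ≤ skewDot A A := by
  rw [skewDot_self_eq_sum]
  exact Finset.sum_nonneg fun i _ => Finset.sum_nonneg fun j _ => by split_ifs <;> positivity

theorem eq_zero_of_skewDot_self {A : Fin N → Fin N → ℝ} (h : skewDot A A = 0) {i j : Fin N}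
    (hij : i < j) : A i j = 0 := by
  rw [skewDot_self_eq_sum] at h
  have hnn : ∀ i j : Fin N, 0 ≤ if i < j then A i j ^ 2 else 0 := fun i j => by
    split_ifs <;> positivity
  have h1 := (Finset.sum_eq_zero_iff_of_nonneg fun i _ => Finset.sum_nonneg fun j _ => hnn i j).1 h
    i (Finset.mem_univ i)
  have h2 := (Finset.sum_eq_zero_iff_of_nonneg fun j _ => hnn i j).1 h1 j (Finset.mem_univ j)
  simpa [hij] using h2

theorem linear_single_comm_of_curl {u : Pt N →ᵃ[ℝ] Pt N} (h : skewDot (curl u) (curl u) = 0)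
    (i j : Fin N) :
    u.linear (EuclideanSpace.single i 1) j = u.linear (EuclideanSpace.single j 1) i := by
  rcases lt_trichotomy i j with hij | rfl | hij
  · exact sub_eq_zero.1 (eq_zero_of_skewDot_self h hij)
  · rfl
  · exact (sub_eq_zero.1 (eq_zero_of_skewDot_self h hij)).symm

end LinearAlgebra

namespace Mesh

variable {N : ℕ} {Ω : Set (Pt N)} {T : Mesh N Ω} (o : T.Orientation)

/-- An affine field that vanishes on an inner face has a gradient that vanishes on the tangential
directions. -/
theorem Orientation.linear_eq_zero_of_orthogonal (hN : 1 ≤ N) {F : T.InnerFace}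
    {l : Pt N →ᵃ[ℝ] Pt N} (hl : ∀ x ∈ F.1.1, l x = 0) {τ : Pt N} (hτ : ⟪o.normal F, τ⟫ = 0) :
    l.linear τ = 0 := by
  classical
  obtain ⟨p, hp⟩ := o.exists_vertex_minus F
  obtain ⟨x, hx⟩ := F.nonempty hN
  have hpF : (p : Pt N) ∉ F.1.1 := by rw [hp]; exact Finset.notMem_erase _ _
  set b := (o.minus F).basis
  set j : (o.minus F).1 := ⟨x, o.subset_minus F hx⟩
  have hd : ⟪o.normal F, b p - b j⟫ ≠ 0 := (o.minus_side F p p.2 hpF x hx).ne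
  have hmem : ∀ i ≠ p, b i ∈ F.1.1 := by
    intro i hi
    rw [hp]
    exact Finset.mem_erase.2 ⟨fun h => hi (Subtype.ext h), i.2⟩
  have hνb : ∀ i ≠ p, ⟪o.normal F, b i - b j⟫ = 0 := fun i hi =>
    o.normal_orthogonal F _ (hmem i hi) _ hx
  have h0 : b.coord p (τ + b j) = 0 := by
    have := inner_sub_eq_coord_mul b p hνb (τ + b j)
    rw [add_sub_cancel_right, hτ] at this
    exact (mul_eq_zero.1 this.symm).resolve_right hd
  have h1 : l.linear τ = l (τ + b j) := by
    have := l.map_vadd (b j) τ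
    rw [vadd_eq_add, vadd_eq_add, hl (b j) hx, add_zero] at this
    exact this.symm
  rw [h1]
  ext k
  have h2 := affineMap_eq_sum_coord b
    (((EuclideanSpace.proj k : Pt N →L[ℝ] ℝ) : Pt N →ₗ[ℝ] ℝ).toAffineMap.comp l) (τ + b j)
  have h3 : l (τ + b j) k = ∑ i, b.coord i (τ + b j) * l (b i) k := h2
  rw [h3]
  refine Finset.sum_eq_zero fun i _ => ?_
  rcases eq_or_ne i p with rfl | hi
  · rw [h0, zero_mul]
  · rw [hl _ (hmem i hi)]; simp

/-- The bilinear form of the momentum equation is definite: a field of the Crouzeix-Raviart space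
without curl, divergence and jumps vanishes. The gradients are symmetric and trace free, so they do
not jump over the inner faces, and the divergence theorem for the fields `∇u u` and `|u|² x`
applies. -/
theorem Orientation.eq_zero_of_curl_divg_jump (hN : 1 ≤ N) {u : PwAffine T}
    (hu : u ∈ crouzeixRaviart o) (hcurl : ∀ E, skewDot (curl (u E)) (curl (u E)) = 0)
    (hdiv : ∀ E, divg (u E) = 0) (hjump : ∀ F : T.InnerFace, ∀ x ∈ F.carrier, jump o u F x = 0) :
    u = 0 := by
  classical
  have hvert : ∀ F : T.InnerFace, ∀ x ∈ F.1.1, x ∈ F.carrier := fun F x hx =>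
    subset_convexHull ℝ _ hx
  have hsymm : ∀ E, (u E).linear.IsSymmetric := fun E =>
    isSymmetric_of_forall_apply_single (linear_single_comm_of_curl (hcurl E))
  have hgrad : ∀ F, (u (o.plus F)).linear = (u (o.minus F)).linear := by
    intro F
    rw [← sub_eq_zero]
    refine eq_zero_of_isSymmetric_of_orthogonal ((hsymm _).sub (hsymm _)) ?_ (o.norm_normal F)
      fun τ hτ => ?_
    · have h1 := hdiv (o.plus F)
      have h2 := hdiv (o.minus F)
      simp only [divg, pderiv] at h1 h2
      simp [Finset.sum_sub_distrib, h1, h2]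
    · have := o.linear_eq_zero_of_orthogonal hN (l := u (o.plus F) - u (o.minus F))
        (fun x hx => hjump F x (hvert F x hx)) hτ
      simpa using this
  -- The field `∇u u` has the divergence `|∇u|²`.
  have hlin : ∀ E, (u E).linear = 0 := by
    have hdw : ∀ E, divg ((u E).linear.toAffineMap.comp (u E)) =
        ∑ i, ‖(u E).linear (EuclideanSpace.single i 1)‖ ^ 2 := by
      intro E
      refine Finset.sum_congr rfl fun i _ => ?_
      rw [← real_inner_self_eq_norm_sq, (hsymm E)]
      simp [pderiv, EuclideanSpace.inner_single_left]
    have hsum := o.sum_volume_mul_divg hN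
      (w := fun E => (u E).linear.toAffineMap.comp (u E)) (fun F hF E hE => ?_)
    · have hz : ∑ E : T.Elem, volume.real E.carrier *
          ∑ i, ‖(u E).linear (EuclideanSpace.single i 1)‖ ^ 2 = 0 := by
        simp_rw [hdw] at hsum
        rw [hsum]
        refine Finset.sum_eq_zero fun F _ => ?_
        rw [sub_eq_zero]
        refine setIntegral_congr_fun
          (((Finset.finite_toSet _).isCompact_convexHull ℝ).measurableSet) fun x hx => ?_
        have : u (o.plus F) x = u (o.minus F) x := sub_eq_zero.1 (hjump F x hx)
        simp only [AffineMap.comp_apply, this, LinearMap.coe_toAffineMap, hgrad F]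
      intro E
      have h1 := (Finset.sum_eq_zero_iff_of_nonneg fun E _ => mul_nonneg measureReal_nonneg
        (Finset.sum_nonneg fun i _ => sq_nonneg _)).1 hz E (Finset.mem_univ E)
      have h2 := (mul_eq_zero.1 h1).resolve_left E.volume_real_pos.ne'
      refine (EuclideanSpace.basisFun (Fin N) ℝ).toBasis.ext fun i => ?_
      have h3 := (Finset.sum_eq_zero_iff_of_nonneg fun i _ => sq_nonneg _).1 h2 i
        (Finset.mem_univ i)
      simpa using h3
    · obtain ⟨p, hp⟩ := E.exists_eq_erase F.2.2 hE
      have hu0 := hu.2 F hF E hE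
      rw [hp, ← Elem.oppFace_basis] at hu0 ⊢
      have := (LinearMap.toContinuousLinearMap (u E).linear).integral_comp_comm
        (integrableOn_oppFace E.basis p hN (u E).continuous_of_finiteDimensional)
      rw [hu0, map_zero] at this
      exact this
  have hconst : ∀ E x, u E x = u E 0 := by
    intro E x
    have := (u E).linearMap_vsub x 0
    rw [hlin, LinearMap.zero_apply, vsub_eq_sub, eq_comm, sub_eq_zero] at this
    exact this
  have hbdry : ∀ F : T.Face, simplex F.1 ⊆ frontier Ω → ∀ E : T.Elem, F.1 ⊆ E.1 → u E 0 = 0 := by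
    intro F hF E hE
    obtain ⟨p, hp⟩ := E.exists_eq_erase F.2.2 hE
    have hu0 := hu.2 F hF E hE
    simp_rw [hconst E] at hu0
    rw [hp, ← Elem.oppFace_basis, setIntegral_const] at hu0
    exact (smul_eq_zero.1 hu0).resolve_left (surf_real_oppFace_pos E.basis p hN).ne'
  -- Now `u` is constant on each element, and `|u|² x` has the divergence `N |u|²`.
  have hsum := o.sum_volume_mul_divg hN
    (w := fun E => ‖u E 0‖ ^ 2 • (AffineMap.id ℝ (Pt N))) (fun F hF E hE => ?_)
  · have hz : ∑ E : T.Elem, volume.real E.carrier * (‖u E 0‖ ^ 2 * N) = 0 := by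
      have hdw : ∀ E, divg (‖u E 0‖ ^ 2 • (AffineMap.id ℝ (Pt N))) = ‖u E 0‖ ^ 2 * N := by
        intro E
        simp [divg, pderiv, mul_comm]
      simp_rw [hdw] at hsum
      rw [hsum]
      refine Finset.sum_eq_zero fun F _ => ?_
      obtain ⟨x, hx⟩ := F.nonempty hN
      have : u (o.plus F) x = u (o.minus F) x := sub_eq_zero.1 (hjump F x (hvert F x hx))
      rw [hconst, hconst (o.minus F)] at this
      rw [this, sub_self]
    funext E
    have h1 := (Finset.sum_eq_zero_iff_of_nonneg fun E _ => mul_nonneg measureReal_nonneg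
      (mul_nonneg (sq_nonneg _) (Nat.cast_nonneg _))).1 hz E (Finset.mem_univ E)
    have h2 := (mul_eq_zero.1 h1).resolve_left E.volume_real_pos.ne'
    have h3 := (mul_eq_zero.1 h2).resolve_right (by exact_mod_cast (by omega : N ≠ 0))
    ext1 x
    rw [hconst]
    simpa using h3
  · rw [hbdry F hF E hE]
    simp

end Mesh

/-! ### The implicit upwind step -/

section Upwind

variable {I J : Type*} [Fintype I] [Fintype J] (l r : J → I) (m : I → ℝ)

/-- The equation `∑ m (ρ - ρ₀) φ = ∑ (ρ₋ β⁺ + ρ₊ β⁻) (φ₊ - φ₋)` of an implicit upwind step on a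
graph, with the weight `m i` at the vertex `i` and the flux `β F` along the edge `F` from `l F` to
`r F`; the values `ρ₋`, `ρ₊` are those at `l F`, `r F`. -/
def UpwindEq (β : J → ℝ) (ρ₀ ρ : I → ℝ) : Prop :=
  ∀ φ : I → ℝ, ∑ i, m i * (ρ i - ρ₀ i) * φ i =
    ∑ F, (ρ (l F) * max (β F) 0 + ρ (r F) * min (β F) 0) * (φ (r F) - φ (l F))

variable {l r m}

omit [Fintype I] in
/-- The net upwind flux into the set where `P` holds is nonnegative, if `ρ ≤ 0` on this set and
`0 ≤ ρ` off it. -/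
theorem upwind_indicator_nonneg (β : J → ℝ) {ρ : I → ℝ} {P : I → Prop} [DecidablePred P]
    (hP : ∀ i, P i → ρ i ≤ 0) (hP' : ∀ i, ¬ P i → 0 ≤ ρ i) :
    0 ≤ ∑ F, (ρ (l F) * max (β F) 0 + ρ (r F) * min (β F) 0) *
      ((if P (r F) then (1 : ℝ) else 0) - if P (l F) then (1 : ℝ) else 0) := by
  refine Finset.sum_nonneg fun F _ => ?_
  have h1 : 0 ≤ max (β F) 0 := le_max_right _ _
  have h2 : min (β F) 0 ≤ 0 := min_le_right _ _
  by_cases hr : P (r F) <;> by_cases hl : P (l F)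
  · simp [hr, hl]
  · have := mul_nonneg (hP' _ hl) h1
    have := mul_nonneg_of_nonpos_of_nonpos (hP _ hr) h2
    simp only [hr, hl, if_true, if_false]; linarith
  · have := mul_nonpos_of_nonpos_of_nonneg (hP _ hl) h1
    have := mul_nonpos_of_nonneg_of_nonpos (hP' _ hr) h2
    simp only [hr, hl, if_true, if_false]; linarith
  · simp [hr, hl]

theorem UpwindEq.nonneg (hm : ∀ i, 0 < m i) {β : J → ℝ} {ρ : I → ℝ}
    (h : UpwindEq l r m β 0 ρ) (i : I) : 0 ≤ ρ i := by
  classical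
  by_contra! hi
  have h1 := upwind_indicator_nonneg (l := l) (r := r) β (ρ := ρ) (P := fun i => ρ i < 0)
    (fun i h => h.le) (fun i h => not_lt.1 h)
  rw [← h fun i => if ρ i < 0 then 1 else 0] at h1
  refine h1.not_gt (Finset.sum_neg' (fun j _ => ?_) ⟨i, Finset.mem_univ i, ?_⟩)
  · split_ifs with hj
    · have := mul_neg_of_pos_of_neg (hm j) hj
      simp only [Pi.zero_apply]; linarith
    · simp
  · have := mul_neg_of_pos_of_neg (hm i) hi
    simp only [Pi.zero_apply, if_pos hi]; linarith

theorem UpwindEq.pos (hm : ∀ i, 0 < m i) {β : J → ℝ} {ρ₀ ρ : I → ℝ} (hρ₀ : ∀ i, 0 < ρ₀ i)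
    (h : UpwindEq l r m β ρ₀ ρ) (i : I) : 0 < ρ i := by
  classical
  by_contra! hi
  have h1 := upwind_indicator_nonneg (l := l) (r := r) β (ρ := ρ) (P := fun i => ρ i ≤ 0)
    (fun i h => h) (fun i h => (not_le.1 h).le)
  rw [← h fun i => if ρ i ≤ 0 then 1 else 0] at h1
  have hneg : ∀ j, ρ j ≤ 0 → m j * (ρ j - ρ₀ j) < 0 := fun j hj =>
    mul_neg_of_pos_of_neg (hm j) (by linarith [hρ₀ j])
  refine h1.not_gt (Finset.sum_neg' (fun j _ => ?_) ⟨i, Finset.mem_univ i, ?_⟩)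
  · split_ifs with hj
    · linarith [hneg j hj]
    · simp
  · rw [if_pos hi, mul_one]; exact hneg i hi

variable [DecidableEq I] (l r m)

/-- The matrix of the implicit upwind step. -/
def upwindMatrix (β : J → ℝ) : Matrix I I ℝ := Matrix.of fun i j =>
  (if i = j then m i else 0) - ∑ F, ((if l F = j then max (β F) 0 else 0) +
    (if r F = j then min (β F) 0 else 0)) * ((if r F = i then 1 else 0) - if l F = i then 1 else 0)

theorem sum_upwindMatrix_mulVec (β : J → ℝ) (ρ φ : I → ℝ) :
    ∑ i, (upwindMatrix l r m β).mulVec ρ i * φ i = ∑ i, m i * ρ i * φ i -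
      ∑ F, (ρ (l F) * max (β F) 0 + ρ (r F) * min (β F) 0) * (φ (r F) - φ (l F)) := by
  have h1 : ∀ i, (upwindMatrix l r m β).mulVec ρ i = m i * ρ i -
      ∑ F, (ρ (l F) * max (β F) 0 + ρ (r F) * min (β F) 0) *
        ((if r F = i then 1 else 0) - if l F = i then 1 else 0) := by
    intro i
    simp only [Matrix.mulVec, dotProduct, upwindMatrix, Matrix.of_apply, sub_mul _ _ (ρ _),
      Finset.sum_sub_distrib]
    congr 1
    · simp
    · simp_rw [Finset.sum_mul]
      rw [Finset.sum_comm]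
      refine Finset.sum_congr rfl fun F _ => ?_
      have : ∀ j, ((if l F = j then max (β F) 0 else 0) + (if r F = j then min (β F) 0 else 0)) *
          ((if r F = i then (1 : ℝ) else 0) - if l F = i then 1 else 0) * ρ j =
          ((if l F = j then ρ j * max (β F) 0 else 0) + (if r F = j then ρ j * min (β F) 0 else 0)) *
          ((if r F = i then 1 else 0) - if l F = i then 1 else 0) := by
        intro j
        split_ifs <;> ring
      simp_rw [this]
      rw [← Finset.sum_mul, Finset.sum_add_distrib, Finset.sum_ite_eq, Finset.sum_ite_eq]
      simp
  simp_rw [h1, sub_mul _ _ (φ _), Finset.sum_sub_distrib]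
  congr 1
  simp_rw [Finset.sum_mul]
  rw [Finset.sum_comm]
  refine Finset.sum_congr rfl fun F _ => ?_
  simp_rw [mul_assoc]
  rw [← Finset.mul_sum]
  congr 1
  simp [sub_mul, Finset.sum_sub_distrib]

theorem upwindEq_iff (β : J → ℝ) (ρ₀ ρ : I → ℝ) :
    UpwindEq l r m β ρ₀ ρ ↔ (upwindMatrix l r m β).mulVec ρ = fun i => m i * ρ₀ i := by
  constructor
  · intro h
    funext i
    have h1 := sum_upwindMatrix_mulVec l r m β ρ (Pi.single i 1)
    rw [← h (Pi.single i 1), ← Finset.sum_sub_distrib] at h1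
    have h2 : ∀ j, m j * ρ j * (Pi.single i 1 : I → ℝ) j -
        m j * (ρ j - ρ₀ j) * (Pi.single i 1 : I → ℝ) j =
        m j * ρ₀ j * (Pi.single i 1 : I → ℝ) j := fun j => by ring
    simp_rw [h2] at h1
    simpa [Pi.single_apply] using h1
  · intro h φ
    have h1 := sum_upwindMatrix_mulVec l r m β ρ φ
    rw [h] at h1
    rw [eq_sub_iff_add_eq'] at h1
    rw [← sub_eq_iff_eq_add.2 h1.symm, ← Finset.sum_sub_distrib]
    exact Finset.sum_congr rfl fun i _ => by ring

theorem upwindMatrix_det_ne_zero (hm : ∀ i, 0 < m i) (β : J → ℝ) :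
    (upwindMatrix l r m β).det ≠ 0 := by
  intro h
  obtain ⟨v, hv, hv0⟩ := Matrix.exists_mulVec_eq_zero_iff.2 h
  have h1 : UpwindEq l r m β 0 v := by
    rw [upwindEq_iff, hv0]; funext i; simp
  have h2 : UpwindEq l r m β 0 (-v) := by
    rw [upwindEq_iff, Matrix.mulVec_neg, hv0]; funext i; simp
  refine hv (funext fun i => le_antisymm ?_ (h1.nonneg hm i))
  have := h2.nonneg hm i
  simpa using this

/-- The solution of the implicit upwind step. -/
def upwindSol (ρ₀ : I → ℝ) (β : J → ℝ) : I → ℝ :=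
  (upwindMatrix l r m β)⁻¹.mulVec fun i => m i * ρ₀ i

theorem upwindEq_upwindSol (hm : ∀ i, 0 < m i) (ρ₀ : I → ℝ) (β : J → ℝ) :
    UpwindEq l r m β ρ₀ (upwindSol l r m ρ₀ β) := by
  rw [upwindEq_iff, upwindSol, Matrix.mulVec_mulVec, Matrix.mul_nonsing_inv, Matrix.one_mulVec]
  exact (upwindMatrix_det_ne_zero l r m hm β).isUnit

theorem continuous_upwindSol (hm : ∀ i, 0 < m i) (ρ₀ : I → ℝ) :
    Continuous (upwindSol l r m ρ₀) := by
  have hM : Continuous (upwindMatrix l r m : (J → ℝ) → Matrix I I ℝ) := by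
    refine continuous_matrix fun i j => ?_
    simp only [upwindMatrix, Matrix.of_apply]
    refine continuous_const.sub (continuous_finsetSum _ fun F _ => Continuous.mul ?_ continuous_const)
    refine Continuous.add ?_ ?_
    · split_ifs <;> fun_prop
    · split_ifs <;> fun_prop
  unfold upwindSol
  simp_rw [Matrix.inv_def, Ring.inverse_eq_inv']
  exact ((hM.matrix_det.inv₀ (upwindMatrix_det_ne_zero l r m hm)).smul
    hM.matrix_adjugate).matrix_mulVec continuous_const

end Upwind

section Energy

/-- The convexity of `s ↦ s ^ γ`. -/
theorem rpow_tangent_le {γ s t : ℝ} (hγ : 1 < γ) (hs : 0 < s) (ht : 0 < t) :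
    t ^ γ + γ * t ^ (γ - 1) * (s - t) ≤ s ^ γ := by
  have h := one_add_mul_self_le_rpow_one_add (s := s / t - 1)
    (by have := div_pos hs ht; linarith) hγ.le
  rw [add_sub_cancel, Real.div_rpow hs.le ht.le, le_div_iff₀ (Real.rpow_pos_of_pos ht γ)] at h
  have h1 : t ^ γ = t ^ (γ - 1) * t := by
    rw [← Real.rpow_add_one ht.ne', sub_add_cancel]
  have h2 : (1 + γ * (s / t - 1)) * t ^ γ = t ^ γ + γ * t ^ (γ - 1) * (s - t) := by
    rw [h1]; field_simp
  linarith

/-- The renormalized form of the upwind flux: with `P'(s) = γ / (γ - 1) s ^ (γ - 1)`, the product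
of the upwind flux and the jump of `P'` is at most the flux times the jump of the pressure. -/
theorem upwind_flux_mul_le {γ s t β : ℝ} (hγ : 1 < γ) (hs : 0 < s) (ht : 0 < t) :
    (s * max β 0 + t * min β 0) * (γ / (γ - 1) * t ^ (γ - 1) - γ / (γ - 1) * s ^ (γ - 1)) ≤
      β * (t ^ γ - s ^ γ) := by
  have key : ∀ {x y : ℝ}, 0 < x → 0 < y →
      x * (γ / (γ - 1) * y ^ (γ - 1) - γ / (γ - 1) * x ^ (γ - 1)) ≤ y ^ γ - x ^ γ := by
    intro x y hx hy
    have h1 := rpow_tangent_le hγ hx hy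
    have h2 : x ^ γ = x ^ (γ - 1) * x := by rw [← Real.rpow_add_one hx.ne', sub_add_cancel]
    have h3 : y ^ γ = y ^ (γ - 1) * y := by rw [← Real.rpow_add_one hy.ne', sub_add_cancel]
    have h4 : 0 < γ - 1 := by linarith
    have h5 : x * (γ / (γ - 1) * y ^ (γ - 1) - γ / (γ - 1) * x ^ (γ - 1)) =
        (γ * (x * y ^ (γ - 1)) - γ * x ^ γ) / (γ - 1) := by
      rw [h2]; field_simp
    rw [h5, div_le_iff₀ h4]
    rw [h3] at h1 ⊢
    nlinarith
  have h1 := mul_le_mul_of_nonneg_left (key hs ht) (le_max_right β 0)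
  have h2 := mul_le_mul_of_nonneg_left (key ht hs) (neg_nonneg.2 (min_le_right β 0))
  have h3 : max β 0 + min β 0 = β := by rw [max_add_min, add_zero]
  have h4 : β * (t ^ γ - s ^ γ) = max β 0 * (t ^ γ - s ^ γ) + -min β 0 * (s ^ γ - t ^ γ) := by
    conv_lhs => rw [← h3]
    ring
  rw [h4]
  linarith

/-- The energy estimate of the implicit upwind step. -/
theorem UpwindEq.energy {I J : Type*} [Fintype I] [Fintype J] {l r : J → I} {m : I → ℝ}
    (hm : ∀ i, 0 < m i) {β : J → ℝ} {ρ₀ ρ : I → ℝ} (hρ₀ : ∀ i, 0 < ρ₀ i)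
    (h : UpwindEq l r m β ρ₀ ρ) {γ : ℝ} (hγ : 1 < γ) :
    ∑ F, β F * (ρ (l F) ^ γ - ρ (r F) ^ γ) ≤ ∑ i, m i * (ρ₀ i ^ γ / (γ - 1)) := by
  have hρ := h.pos hm hρ₀
  have hγ1 : 0 < γ - 1 := by linarith
  have h1 := h fun i => γ / (γ - 1) * ρ i ^ (γ - 1)
  have h2 : ∑ F, (ρ (l F) * max (β F) 0 + ρ (r F) * min (β F) 0) *
      (γ / (γ - 1) * ρ (r F) ^ (γ - 1) - γ / (γ - 1) * ρ (l F) ^ (γ - 1)) ≤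
      ∑ F, β F * (ρ (r F) ^ γ - ρ (l F) ^ γ) :=
    Finset.sum_le_sum fun F _ => upwind_flux_mul_le hγ (hρ _) (hρ _)
  have h3 : ∑ i, -(m i * (ρ₀ i ^ γ / (γ - 1))) ≤
      ∑ i, m i * (ρ i - ρ₀ i) * (γ / (γ - 1) * ρ i ^ (γ - 1)) := by
    refine Finset.sum_le_sum fun i _ => ?_
    have h4 := rpow_tangent_le hγ (hρ₀ i) (hρ i)
    have h5 := Real.rpow_pos_of_pos (hρ i) γ
    have h6 : m i * (ρ i - ρ₀ i) * (γ / (γ - 1) * ρ i ^ (γ - 1)) =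
        m i * ((γ * ρ i ^ (γ - 1) * (ρ i - ρ₀ i)) / (γ - 1)) := by ring
    rw [h6, ← mul_neg, ← neg_div]
    refine mul_le_mul_of_nonneg_left (div_le_div_of_nonneg_right ?_ hγ1.le) (hm i).le
    linarith
  rw [Finset.sum_neg_distrib] at h3
  have h7 : ∑ F, β F * (ρ (l F) ^ γ - ρ (r F) ^ γ) = -∑ F, β F * (ρ (r F) ^ γ - ρ (l F) ^ γ) := by
    rw [← Finset.sum_neg_distrib]
    exact Finset.sum_congr rfl fun F _ => by ring
  linarith

end Energy

section Solver

open Classical in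
/-- Existence for one step of an abstract scheme, in which an implicit upwind step is coupled with
a definite linear problem by the pressure. -/
theorem exists_upwind_coupled {I J : Type*} [Fintype I] [Fintype J] {l r : J → I} {m : I → ℝ}
    (hm : ∀ i, 0 < m i) {W : Type*} [AddCommGroup W] [Module ℝ W] [FiniteDimensional ℝ W]
    (A : W →ₗ[ℝ] W →ₗ[ℝ] ℝ) (hA : ∀ u, u ≠ 0 → 0 < A u u) (d : I → W →ₗ[ℝ] ℝ)
    (β : J → W →ₗ[ℝ] ℝ)
    (hd : ∀ (q : I → ℝ) (u : W), ∑ i, q i * d i u = ∑ F, β F u * (q (l F) - q (r F)))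
    (g : W →ₗ[ℝ] ℝ) {ρ₀ : I → ℝ} (hρ₀ : ∀ i, 0 < ρ₀ i) {a γ : ℝ} (ha : 0 < a) (hγ : 1 < γ) :
    ∃ (ρ : I → ℝ) (u : W), (∀ i, 0 < ρ i) ∧ UpwindEq l r m (fun F => β F u) ρ₀ ρ ∧
      ∀ v, A u v - ∑ i, a * ρ i ^ γ * d i v = g v := by
  set V := EuclideanSpace ℝ (Fin (finrank ℝ W))
  set e : V ≃ₗ[ℝ] W := LinearEquiv.ofFinrankEq _ _ finrank_euclideanSpace_fin
  set ρ : V → I → ℝ := fun ξ => upwindSol l r m ρ₀ fun F => β F (e ξ)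
  have hρeq : ∀ ξ, UpwindEq l r m (fun F => β F (e ξ)) ρ₀ (ρ ξ) := fun ξ =>
    upwindEq_upwindSol l r m hm ρ₀ _
  have hρpos : ∀ ξ i, 0 < ρ ξ i := fun ξ => (hρeq ξ).pos hm hρ₀
  have hlinc : ∀ L : W →ₗ[ℝ] ℝ, Continuous fun ξ : V => L (e ξ) := fun L =>
    (L ∘ₗ (e : V →ₗ[ℝ] W)).continuous_of_finiteDimensional
  have hρc : Continuous ρ := (continuous_upwindSol l r m hm ρ₀).comp
    (continuous_pi fun F => hlinc (β F))
  set L : V → W →ₗ[ℝ] ℝ := fun ξ => A (e ξ) - ∑ i, (a * ρ ξ i ^ γ) • d i - g with hL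
  have hLapp : ∀ ξ v, L ξ v = A (e ξ) v - ∑ i, a * ρ ξ i ^ γ * d i v - g v := by
    intro ξ v
    simp [hL, LinearMap.sub_apply, LinearMap.sum_apply]
  have hexp : ∀ (M : W →ₗ[ℝ] ℝ) (ξ : V),
      M (e ξ) = ∑ k, ξ k * M (e (EuclideanSpace.single k 1)) := by
    intro M ξ
    conv_lhs => rw [← (EuclideanSpace.basisFun _ ℝ).sum_repr ξ, map_sum, map_sum]
    simp [map_smul]
  set Φ : V → V := fun ξ => WithLp.toLp 2 fun k => L ξ (e (EuclideanSpace.single k 1)) with hΦ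
  have hΦi : ∀ ξ η, ⟪Φ ξ, η⟫ = L ξ (e η) := by
    intro ξ η
    rw [hexp, PiLp.inner_apply]
    exact Finset.sum_congr rfl fun k _ => by simp [hΦ]
  have hΦc : Continuous Φ := by
    refine (PiLp.continuous_toLp 2 _).comp (continuous_pi fun k => ?_)
    simp_rw [hLapp]
    refine (Continuous.sub (hlinc (A.flip _)) (continuous_finsetSum _ fun i _ => ?_)).sub
      continuous_const
    refine (continuous_const.mul ?_).mul continuous_const
    exact ((continuous_apply i).comp hρc).rpow_const fun ξ => Or.inl (hρpos ξ i).ne'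
  -- Coercivity of the quadratic form, by compactness of the unit sphere.
  have hAc : Continuous fun ξ : V => A (e ξ) (e ξ) := by
    simp_rw [fun ξ => hexp (A (e ξ)) ξ]
    refine continuous_finsetSum _ fun k _ => Continuous.mul
      (PiLp.continuous_apply 2 _ k) (hlinc (A.flip _))
  obtain ⟨c, hc, hcoer⟩ : ∃ c > 0, ∀ ξ : V, c * ‖ξ‖ ^ 2 ≤ A (e ξ) (e ξ) := by
    rcases (sphere (0 : V) 1).eq_empty_or_nonempty with hemp | hne
    · refine ⟨1, one_pos, fun ξ => ?_⟩
      have : ξ = 0 := by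
        by_contra h
        have : ‖ξ‖⁻¹ • ξ ∈ sphere (0 : V) 1 := by
          rw [mem_sphere_zero_iff_norm, norm_smul, norm_inv, norm_norm,
            inv_mul_cancel₀ (norm_ne_zero_iff.2 h)]
        rw [hemp] at this; exact this
      simp [this]
    · obtain ⟨ξ₀, hξ₀, hmin⟩ := (isCompact_sphere (0 : V) 1).exists_isMinOn hne hAc.continuousOn
      refine ⟨A (e ξ₀) (e ξ₀), hA _ ?_, fun ξ => ?_⟩
      · rw [Ne, e.map_eq_zero_iff]
        rintro rfl
        simp at hξ₀
      · by_cases h : ξ = 0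
        · simp [h]
        have hn := norm_ne_zero_iff.2 h
        have hmem : ‖ξ‖⁻¹ • ξ ∈ sphere (0 : V) 1 := by
          rw [mem_sphere_zero_iff_norm, norm_smul, norm_inv, norm_norm, inv_mul_cancel₀ hn]
        have h1 : A (e ξ₀) (e ξ₀) ≤ A (e (‖ξ‖⁻¹ • ξ)) (e (‖ξ‖⁻¹ • ξ)) := hmin hmem
        rw [map_smul, map_smul, map_smul, LinearMap.smul_apply, smul_eq_mul, smul_eq_mul] at h1
        calc _ ≤ ‖ξ‖⁻¹ * (‖ξ‖⁻¹ * A (e ξ) (e ξ)) * ‖ξ‖ ^ 2 := by gcongr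
          _ = A (e ξ) (e ξ) := by field_simp
  set C := a * ∑ i, m i * (ρ₀ i ^ γ / (γ - 1))
  have hC0 : 0 ≤ C := by
    refine mul_nonneg ha.le (Finset.sum_nonneg fun i _ => mul_nonneg (hm i).le ?_)
    exact div_nonneg (Real.rpow_nonneg (hρ₀ i).le _) (by linarith)
  have hpress : ∀ ξ, ∑ i, a * ρ ξ i ^ γ * d i (e ξ) ≤ C := by
    intro ξ
    simp_rw [mul_assoc]
    rw [← Finset.mul_sum, hd]
    exact mul_le_mul_of_nonneg_left ((hρeq ξ).energy hm hρ₀ hγ) ha.le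
  set G := ‖LinearMap.toContinuousLinearMap (g ∘ₗ (e : V →ₗ[ℝ] W))‖
  have hg : ∀ ξ, g (e ξ) ≤ G * ‖ξ‖ := fun ξ =>
    (le_abs_self _).trans ((LinearMap.toContinuousLinearMap (g ∘ₗ (e : V →ₗ[ℝ] W))).le_opNorm ξ)
  have hG0 : 0 ≤ G := norm_nonneg _
  -- On the sphere of radius `x` the residual is at least `c x² - C - G x`.
  obtain ⟨ξ, hξ⟩ := exists_eq_zero_of_inner_pos hΦc (R := 1 + (C + G) / c) (by positivity)
    (fun ξ hξ => by
      rw [hΦi, hLapp]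
      have h1 := hcoer ξ
      have h2 := hpress ξ
      have h3 := hg ξ
      have h4 : 1 ≤ ‖ξ‖ := le_trans (by have : 0 ≤ (C + G) / c := by positivity
                                        linarith) hξ
      have h5 : c + (C + G) ≤ c * ‖ξ‖ := by
        calc c + (C + G) = c * (1 + (C + G) / c) := by field_simp
          _ ≤ _ := by gcongr
      have h6 : (c + (C + G)) * ‖ξ‖ ≤ c * ‖ξ‖ * ‖ξ‖ := by gcongr
      have h7 : (c + C) * 1 ≤ (c + C) * ‖ξ‖ := by gcongr
      nlinarith)
  refine ⟨ρ ξ, e ξ, hρpos ξ, hρeq ξ, fun v => ?_⟩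
  have h1 := hΦi ξ (e.symm v)
  rw [hξ, inner_zero_left, e.apply_symm_apply, hLapp] at h1
  linarith

end Solver

/-! ### The discrete scheme -/

section Bilinear

variable {N : ℕ}

theorem divg_add (u v : Pt N →ᵃ[ℝ] Pt N) : divg (u + v) = divg u + divg v := by
  simp [divg, pderiv, Finset.sum_add_distrib]

theorem divg_smul (c : ℝ) (u : Pt N →ᵃ[ℝ] Pt N) : divg (c • u) = c * divg u := by
  simp [divg, pderiv, Finset.mul_sum]

theorem curl_add (u v : Pt N →ᵃ[ℝ] Pt N) : curl (u + v) = curl u + curl v := by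
  funext i j
  simp only [curl, pderiv, AffineMap.add_linear, LinearMap.add_apply, PiLp.add_apply, Pi.add_apply]
  ring

theorem curl_smul (c : ℝ) (u : Pt N →ᵃ[ℝ] Pt N) : curl (c • u) = c • curl u := by
  funext i j
  simp only [curl, pderiv, AffineMap.smul_linear, LinearMap.smul_apply, PiLp.smul_apply,
    Pi.smul_apply, smul_eq_mul]
  ring

theorem cross_add_left (a b n : Pt N) : cross (a + b) n = cross a n + cross b n := by
  funext i j
  simp only [cross, PiLp.add_apply, Pi.add_apply]
  ring

theorem cross_smul_left (c : ℝ) (a n : Pt N) : cross (c • a) n = c • cross a n := by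
  funext i j
  simp only [cross, PiLp.smul_apply, Pi.smul_apply, smul_eq_mul]
  ring

theorem skewDot_comm (A B : Fin N → Fin N → ℝ) : skewDot A B = skewDot B A := by
  simp_rw [skewDot, mul_comm]

theorem skewDot_add_left (A B C : Fin N → Fin N → ℝ) :
    skewDot (A + B) C = skewDot A C + skewDot B C := by
  simp_rw [skewDot, ← Finset.sum_add_distrib]
  refine Finset.sum_congr rfl fun i _ => Finset.sum_congr rfl fun j _ => ?_
  split_ifs
  · simp only [Pi.add_apply]; ring
  · simp

theorem skewDot_smul_left (c : ℝ) (A C : Fin N → Fin N → ℝ) :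
    skewDot (c • A) C = c * skewDot A C := by
  simp_rw [skewDot, Finset.mul_sum]
  refine Finset.sum_congr rfl fun i _ => Finset.sum_congr rfl fun j _ => ?_
  split_ifs
  · simp only [Pi.smul_apply, smul_eq_mul]; ring
  · simp

/-- The product of the normal and tangential parts of two vectors with respect to `n`. -/
def faceDot (n a b : Pt N) : ℝ := ⟪a, n⟫ * ⟪b, n⟫ + skewDot (cross a n) (cross b n)

theorem faceDot_comm (n a b : Pt N) : faceDot n a b = faceDot n b a := by
  rw [faceDot, faceDot, skewDot_comm, mul_comm]

theorem faceDot_add_left (n a b c : Pt N) :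
    faceDot n (a + b) c = faceDot n a c + faceDot n b c := by
  simp only [faceDot, inner_add_left, cross_add_left, skewDot_add_left]
  ring

theorem faceDot_smul_left (n : Pt N) (t : ℝ) (a c : Pt N) :
    faceDot n (t • a) c = t * faceDot n a c := by
  simp only [faceDot, real_inner_smul_left, cross_smul_left, skewDot_smul_left]
  ring

theorem faceDot_self_nonneg (n a : Pt N) : 0 ≤ faceDot n a a :=
  add_nonneg (mul_self_nonneg _) (skewDot_self_nonneg _)

theorem eq_zero_of_faceDot_self {n a : Pt N} (hn : ‖n‖ = 1) (h : faceDot n a a = 0) : a = 0 := by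
  have h1 := (add_eq_zero_iff_of_nonneg (mul_self_nonneg _) (skewDot_self_nonneg _)).1 h
  exact eq_zero_of_inner_of_cross hn (mul_self_eq_zero.1 h1.1) fun i j hij =>
    eq_zero_of_skewDot_self h1.2 hij

theorem continuous_faceDot {n : Pt N} {f g : Pt N → Pt N} (hf : Continuous f)
    (hg : Continuous g) : Continuous fun x => faceDot n (f x) (g x) := by
  unfold faceDot skewDot cross
  refine ((hf.inner continuous_const).mul (hg.inner continuous_const)).add
    (continuous_finsetSum _ fun i _ => continuous_finsetSum _ fun j _ => ?_)
  split_ifs <;> fun_prop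

end Bilinear

namespace Mesh

variable {N : ℕ} {Ω : Set (Pt N)} {T : Mesh N Ω} (o : T.Orientation)

theorem Orientation.jump_add (u v : PwAffine T) (F : T.InnerFace) (x : Pt N) :
    jump o (u + v) F x = jump o u F x + jump o v F x := by
  simp only [jump, Pi.add_apply, AffineMap.coe_add]; abel

theorem Orientation.jump_smul (c : ℝ) (u : PwAffine T) (F : T.InnerFace) (x : Pt N) :
    jump o (c • u) F x = c • jump o u F x := by
  simp only [jump, Pi.smul_apply, AffineMap.coe_smul, smul_sub]

theorem Orientation.continuous_jump (u : PwAffine T) (F : T.InnerFace) :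
    Continuous (jump o u F) :=
  (u (o.plus F)).continuous_of_finiteDimensional.sub (u (o.minus F)).continuous_of_finiteDimensional

theorem Elem.integrableOn (E : T.Elem) {f : Pt N → ℝ} (hf : Continuous f) :
    IntegrableOn f E.carrier := by
  rw [← E.convexHull_range_basis]
  exact hf.continuousOn.integrableOn_compact (isCompact_simplex _)

theorem size_pos (hN : 1 ≤ N) (E : T.Elem) : 0 < T.size := by
  have h1 : 1 < E.1.card := by rw [E.2.2]; omega
  obtain ⟨x, hx, y, hy, hxy⟩ := Finset.one_lt_card.1 h1
  have hb : Bornology.IsBounded E.carrier := by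
    rw [← E.convexHull_range_basis]; exact (isCompact_simplex _).isBounded
  have h2 : dist x y ≤ Metric.diam E.carrier :=
    dist_le_diam_of_mem hb (subset_convexHull ℝ _ hx) (subset_convexHull ℝ _ hy)
  have h3 : Metric.diam E.carrier ≤ T.size :=
    le_ciSup (f := fun E : T.Elem => Metric.diam E.carrier) (finite_range _).bddAbove E
  exact (dist_pos.2 hxy).trans_le (h2.trans h3)

/-- The Crouzeix-Raviart space as a linear subspace. -/
def Orientation.crSubmodule (hN : 1 ≤ N) : Submodule ℝ (PwAffine T) where
  carrier := crouzeixRaviart o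
  zero_mem' := ⟨fun F => by simp [jump], fun F _ E _ => by simp⟩
  add_mem' := by
    classical
    rintro u v ⟨hu1, hu2⟩ ⟨hv1, hv2⟩
    refine ⟨fun F => ?_, fun F hF E hE => ?_⟩
    · simp_rw [o.jump_add]
      rw [integral_add (F.integrableOn o hN (o.continuous_jump u F))
        (F.integrableOn o hN (o.continuous_jump v F)), hu1, hv1, add_zero]
    · have h1 := hu2 F hF E hE
      have h2 := hv2 F hF E hE
      obtain ⟨p, hp⟩ := E.exists_eq_erase F.2.2 hE
      rw [hp, ← Elem.oppFace_basis] at h1 h2 ⊢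
      simp only [Pi.add_apply, AffineMap.coe_add]
      rw [integral_add (integrableOn_oppFace E.basis p hN (u E).continuous_of_finiteDimensional)
        (integrableOn_oppFace E.basis p hN (v E).continuous_of_finiteDimensional), h1, h2, add_zero]
  smul_mem' := by
    rintro c u ⟨hu1, hu2⟩
    refine ⟨fun F => ?_, fun F hF E hE => ?_⟩
    · simp_rw [o.jump_smul]
      rw [integral_smul, hu1, smul_zero]
    · simp only [Pi.smul_apply, AffineMap.coe_smul]
      rw [integral_smul, hu2 F hF E hE, smul_zero]

/-- The bilinear form of the momentum equation, with weight `κ` of the jumps. -/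
def Orientation.momentumForm (μ lam κ : ℝ) (u v : PwAffine T) : ℝ :=
  ∑ E : T.Elem, volume.real E.carrier *
      (μ * skewDot (curl (u E)) (curl (v E)) + (μ + lam) * divg (u E) * divg (v E)) +
    μ * ∑ F : T.InnerFace, κ *
      ∫ x in F.carrier, faceDot (o.normal F) (jump o u F x) (jump o v F x) ∂(surf N)

variable (μ lam κ : ℝ)

theorem Orientation.momentumForm_comm (u v : PwAffine T) :
    o.momentumForm μ lam κ u v = o.momentumForm μ lam κ v u := by
  unfold Orientation.momentumForm
  congr 1
  · refine Finset.sum_congr rfl fun E _ => ?_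
    rw [skewDot_comm]; ring
  · simp_rw [fun F x => faceDot_comm (o.normal F) (jump o u F x) (jump o v F x)]

theorem Orientation.momentumForm_add_left (hN : 1 ≤ N) (u u' v : PwAffine T) :
    o.momentumForm μ lam κ (u + u') v =
      o.momentumForm μ lam κ u v + o.momentumForm μ lam κ u' v := by
  unfold Orientation.momentumForm
  have h1 : ∀ F : T.InnerFace,
      ∫ x in F.carrier, faceDot (o.normal F) (jump o (u + u') F x) (jump o v F x) ∂(surf N) =
      (∫ x in F.carrier, faceDot (o.normal F) (jump o u F x) (jump o v F x) ∂(surf N)) +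
      ∫ x in F.carrier, faceDot (o.normal F) (jump o u' F x) (jump o v F x) ∂(surf N) := by
    intro F
    simp_rw [o.jump_add, faceDot_add_left]
    exact integral_add
      (F.integrableOn o hN (continuous_faceDot (o.continuous_jump u F) (o.continuous_jump v F)))
      (F.integrableOn o hN (continuous_faceDot (o.continuous_jump u' F) (o.continuous_jump v F)))
  simp_rw [h1, Pi.add_apply, curl_add, divg_add, skewDot_add_left, mul_add, add_mul,
    Finset.sum_add_distrib, mul_add, Finset.sum_add_distrib]
  ring

theorem Orientation.momentumForm_smul_left (c : ℝ) (u v : PwAffine T) :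
    o.momentumForm μ lam κ (c • u) v = c * o.momentumForm μ lam κ u v := by
  unfold Orientation.momentumForm
  simp_rw [o.jump_smul, faceDot_smul_left, integral_const_mul, Pi.smul_apply, curl_smul, divg_smul,
    skewDot_smul_left]
  rw [mul_add]
  congr 1
  · rw [Finset.mul_sum]
    exact Finset.sum_congr rfl fun E _ => by ring
  · simp_rw [Finset.mul_sum]
    exact Finset.sum_congr rfl fun E _ => by ring

variable {μ lam κ}

/-- The form of the momentum equation is positive definite on the Crouzeix-Raviart space. -/
theorem Orientation.momentumForm_self_pos (hN : 1 ≤ N) (hμ : 0 < μ) (hμlam : 0 < μ + lam)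
    (hκ : ∀ _ : T.InnerFace, 0 < κ) {u : PwAffine T} (hu : u ∈ crouzeixRaviart o) (hu0 : u ≠ 0) :
    0 < o.momentumForm μ lam κ u u := by
  classical
  have hE : ∀ E : T.Elem, 0 ≤ volume.real E.carrier *
      (μ * skewDot (curl (u E)) (curl (u E)) + (μ + lam) * divg (u E) * divg (u E)) := by
    intro E
    rw [mul_assoc (μ + lam)]
    exact mul_nonneg measureReal_nonneg (add_nonneg (mul_nonneg hμ.le (skewDot_self_nonneg _))
      (mul_nonneg hμlam.le (mul_self_nonneg _)))
  have hF : ∀ F : T.InnerFace, 0 ≤ κ *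
      ∫ x in F.carrier, faceDot (o.normal F) (jump o u F x) (jump o u F x) ∂(surf N) := fun F =>
    mul_nonneg (hκ F).le (integral_nonneg fun x => faceDot_self_nonneg _ _)
  have h1 := Finset.sum_nonneg fun E (_ : E ∈ Finset.univ) => hE E
  have h2 := Finset.sum_nonneg fun F (_ : F ∈ Finset.univ) => hF F
  refine lt_of_le_of_ne (add_nonneg h1 (mul_nonneg hμ.le h2)) fun h0 => hu0 ?_
  obtain ⟨hE0, hF0⟩ := (add_eq_zero_iff_of_nonneg h1 (mul_nonneg hμ.le h2)).1 h0.symm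
  have hE1 : ∀ E : T.Elem, μ * skewDot (curl (u E)) (curl (u E)) = 0 ∧
      (μ + lam) * (divg (u E) * divg (u E)) = 0 := by
    intro E
    have := (Finset.sum_eq_zero_iff_of_nonneg fun E _ => hE E).1 hE0 E (Finset.mem_univ E)
    have := (mul_eq_zero.1 this).resolve_left E.volume_real_pos.ne'
    rw [mul_assoc (μ + lam)] at this
    exact (add_eq_zero_iff_of_nonneg (mul_nonneg hμ.le (skewDot_self_nonneg _))
      (mul_nonneg hμlam.le (mul_self_nonneg _))).1 this
  refine o.eq_zero_of_curl_divg_jump hN hu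
    (fun E => (mul_eq_zero.1 (hE1 E).1).resolve_left hμ.ne')
    (fun E => mul_self_eq_zero.1 ((mul_eq_zero.1 (hE1 E).2).resolve_left hμlam.ne'))
    fun F x hx => ?_
  have h3 := (Finset.sum_eq_zero_iff_of_nonneg fun F _ => hF F).1
    ((mul_eq_zero.1 hF0).resolve_left hμ.ne') F (Finset.mem_univ F)
  have h4 := (mul_eq_zero.1 h3).resolve_left (hκ F).ne'
  obtain ⟨p, hp⟩ := F.carrier_eq_oppFace_minus o
  rw [hp] at h4 hx
  exact eq_zero_of_faceDot_self (o.norm_normal F) (eq_zero_of_integral_oppFace_eq_zero _ p hN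
    (continuous_faceDot (o.continuous_jump u F) (o.continuous_jump u F))
    (fun x => faceDot_self_nonneg _ _) h4 hx)

theorem Orientation.surf_mul_avgNormal (hN : 1 ≤ N) (u : PwAffine T) (F : T.InnerFace) :
    (surf N).real F.carrier * avgNormal o u F =
      ∫ x in F.carrier, ⟪u (o.minus F) x, o.normal F⟫ ∂(surf N) := by
  rw [avgNormal, setAverage_eq, smul_eq_mul, mul_inv_cancel_left₀ (F.surf_real_pos o hN).ne']

/-- The traces of a Crouzeix-Raviart field from both sides have the same mean flux. -/
theorem Orientation.integral_inner_plus_eq_minus (hN : 1 ≤ N) {u : PwAffine T}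
    (hu : u ∈ crouzeixRaviart o) (F : T.InnerFace) :
    ∫ x in F.carrier, ⟪u (o.plus F) x, o.normal F⟫ ∂(surf N) =
      ∫ x in F.carrier, ⟪u (o.minus F) x, o.normal F⟫ ∂(surf N) := by
  have h1 := integral_inner (𝕜 := ℝ) (F.integrableOn o hN (o.continuous_jump u F)) (o.normal F)
  have hc : ∀ E, Continuous fun x => ⟪u E x, o.normal F⟫ := fun E =>
    (u E).continuous_of_finiteDimensional.inner continuous_const
  rw [hu.1 F, inner_zero_right] at h1
  rw [← sub_eq_zero, ← integral_sub (F.integrableOn o hN (hc _)) (F.integrableOn o hN (hc _)), ← h1]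
  refine integral_congr_ae (Eventually.of_forall fun x => ?_)
  simp only [jump]
  rw [← inner_sub_left, real_inner_comm]

/-- The duality of the discrete divergence and the upwind fluxes. -/
theorem Orientation.sum_mul_volume_mul_divg (hN : 1 ≤ N) (q : PwConst T) {u : PwAffine T}
    (hu : u ∈ crouzeixRaviart o) :
    ∑ E : T.Elem, q E * (volume.real E.carrier * divg (u E)) =
      ∑ F : T.InnerFace, (∫ x in F.carrier, ⟪u (o.minus F) x, o.normal F⟫ ∂(surf N)) *
        (q (o.minus F) - q (o.plus F)) := by
  have h := o.sum_volume_mul_divg hN (w := fun E => q E • u E) (fun F hF E hE => by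
    simp only [AffineMap.coe_smul, Pi.smul_apply]
    rw [integral_smul, hu.2 F hF E hE, smul_zero])
  simp only [divg_smul, AffineMap.coe_smul, Pi.smul_apply, real_inner_smul_left,
    integral_const_mul, o.integral_inner_plus_eq_minus hN hu] at h
  calc _ = ∑ E : T.Elem, volume.real E.carrier * (q E * divg (u E)) :=
        Finset.sum_congr rfl fun E _ => by ring
    _ = _ := h
    _ = _ := Finset.sum_congr rfl fun F _ => by ring

theorem continuityEq_of_upwindEq (hN : 1 ≤ N) {Δt : ℝ} {r ρ : PwConst T} {u : PwAffine T}
    (h : UpwindEq o.minus o.plus (fun E : T.Elem => volume.real E.carrier / Δt)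
      (fun F => ∫ x in F.carrier, ⟪u (o.minus F) x, o.normal F⟫ ∂(surf N)) r ρ) :
    ContinuityEq o Δt r ρ u := by
  intro φ
  simp only [setIntegral_const, smul_eq_mul]
  calc _ = ∑ E : T.Elem, volume.real E.carrier / Δt * (ρ E - r E) * φ E :=
        Finset.sum_congr rfl fun E _ => by ring
    _ = _ := h φ
    _ = _ := Finset.sum_congr rfl fun F _ => by
        have hs := (F.surf_real_pos o hN).le
        have h1 := mul_max_of_nonneg (avgNormal o u F) 0 hs
        have h2 := mul_min_of_nonneg (avgNormal o u F) 0 hs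
        rw [mul_zero, o.surf_mul_avgNormal hN] at h1 h2
        rw [← h1, ← h2]
        ring

theorem momentumEq_of_momentumForm {a γ ε : ℝ} {g : T.Elem → Pt N} {ρ : PwConst T}
    {u : PwAffine T}
    (h : ∀ v ∈ crouzeixRaviart o, o.momentumForm μ lam (T.size ^ (ε - 1)) u v -
      ∑ E, a * ρ E ^ γ * (volume.real E.carrier * divg (v E)) =
        ∑ E : T.Elem, ∫ x in E.carrier, ⟪g E, v E x⟫) :
    MomentumEq o μ lam a γ ε g ρ u := by
  intro v hv
  rw [← h v hv, Orientation.momentumForm]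
  simp only [setIntegral_const, smul_eq_mul, faceDot]
  rw [add_sub_right_comm, ← Finset.sum_sub_distrib]
  congr 1
  exact Finset.sum_congr rfl fun E _ => by ring

/-- One time step of the scheme. -/
theorem Orientation.exists_step (hN : 1 ≤ N) {a γ ε Δt : ℝ} (hμ : 0 < μ) (hμlam : 0 < μ + lam)
    (ha : 0 < a) (hγ : 1 < γ) (hΔt : 0 < Δt) (g : T.Elem → Pt N) {r : PwConst T}
    (hr : ∀ E, 0 < r E) :
    ∃ (ρ : PwConst T) (u : PwAffine T), (∀ E, 0 < ρ E) ∧ u ∈ crouzeixRaviart o ∧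
      ContinuityEq o Δt r ρ u ∧ MomentumEq o μ lam a γ ε g ρ u := by
  classical
  set W := o.crSubmodule hN
  have hcont : ∀ (v : PwAffine T) E, Continuous (v E) := fun v E =>
    (v E).continuous_of_finiteDimensional
  set A : PwAffine T →ₗ[ℝ] PwAffine T →ₗ[ℝ] ℝ :=
    LinearMap.mk₂ ℝ (o.momentumForm μ lam (T.size ^ (ε - 1)))
      (o.momentumForm_add_left μ lam _ hN) (o.momentumForm_smul_left μ lam _)
      (fun u v v' => by
        rw [o.momentumForm_comm, o.momentumForm_add_left _ _ _ hN, o.momentumForm_comm,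
          o.momentumForm_comm _ _ _ v'])
      (fun c u v => by
        rw [o.momentumForm_comm, o.momentumForm_smul_left, o.momentumForm_comm]; rfl)
  set d : T.Elem → PwAffine T →ₗ[ℝ] ℝ := fun E =>
    { toFun := fun v => volume.real E.carrier * divg (v E)
      map_add' := fun u v => by rw [Pi.add_apply, divg_add, mul_add]
      map_smul' := fun c v => by
        rw [Pi.smul_apply, divg_smul, RingHom.id_apply, smul_eq_mul]; ring }
  set β : T.InnerFace → PwAffine T →ₗ[ℝ] ℝ := fun F =>
    { toFun := fun v => ∫ x in F.carrier, ⟪v (o.minus F) x, o.normal F⟫ ∂(surf N)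
      map_add' := fun u v => by
        simp only [Pi.add_apply, AffineMap.coe_add, inner_add_left]
        exact integral_add (F.integrableOn o hN ((hcont u _).inner continuous_const))
          (F.integrableOn o hN ((hcont v _).inner continuous_const))
      map_smul' := fun c v => by
        simp only [Pi.smul_apply, AffineMap.coe_smul, real_inner_smul_left, integral_const_mul,
          RingHom.id_apply, smul_eq_mul] }
  set G : PwAffine T →ₗ[ℝ] ℝ :=
    { toFun := fun v => ∑ E : T.Elem, ∫ x in E.carrier, ⟪g E, v E x⟫
      map_add' := fun u v => by
        simp only [Pi.add_apply, AffineMap.coe_add, inner_add_right]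
        rw [← Finset.sum_add_distrib]
        exact Finset.sum_congr rfl fun E _ => integral_add
          (E.integrableOn (continuous_const.inner (hcont u E)))
          (E.integrableOn (continuous_const.inner (hcont v E)))
      map_smul' := fun c v => by
        simp only [Pi.smul_apply, AffineMap.coe_smul, real_inner_smul_right, integral_const_mul,
          RingHom.id_apply, smul_eq_mul, Finset.mul_sum] }
  obtain ⟨ρ, u, hρ, hup, hmom⟩ := exists_upwind_coupled (l := o.minus) (r := o.plus)
    (m := fun E : T.Elem => volume.real E.carrier / Δt)
    (fun E => div_pos E.volume_real_pos hΔt) (A.domRestrict₁₂ W W)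
    (fun u hu => o.momentumForm_self_pos hN hμ hμlam
      (fun F => Real.rpow_pos_of_pos (size_pos hN (o.minus F)) _) u.2
      (fun h => hu (Subtype.ext h)))
    (fun E => (d E).domRestrict W) (fun F => (β F).domRestrict W)
    (fun q u => o.sum_mul_volume_mul_divg hN q u.2) (G.domRestrict W) hr ha hγ
  exact ⟨ρ, u, hρ, u.2, continuityEq_of_upwindEq o hN hup,
    momentumEq_of_momentumForm o fun v hv => hmom ⟨v, hv⟩⟩

end Mesh

end CompressibleStokes


end

open CompressibleStokes in
theorem lemma3p3 {N : ℕ} (hN : N = 2 ∨ N = 3)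
    {Ω : Set (Pt N)} (hΩo : IsOpen Ω) (hΩc : IsConnected Ω) (hΩr : interior (closure Ω) = Ω)
    (T : Mesh N Ω) (o : T.Orientation)
    (μ lam a γ ε : ℝ) (hμ : 0 < μ) (hlam : 0 ≤ N * lam + 2 * μ) (hμlam : 0 < μ + lam)
    (ha : 0 < a) (hγ : 1 < γ) (hε : ε ∈ Set.Ioo (0 : ℝ) 1)
    (Tf Δt : ℝ) (hTf : 0 < Tf) (hΔt : 0 < Δt) (M : ℕ) (hM : M * Δt = Tf)
    (f : ℝ → Pt N → Pt N)
    (hf : MeasureTheory.MemLp (fun z : ℝ × Pt N => f z.1 z.2) 2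
      (MeasureTheory.volume.restrict (Set.Ioo 0 Tf ×ˢ Ω)))
    (ρ₀ : PwConst T) (hρ₀ : ∀ E, 0 < ρ₀ E) :
    ∃ (ρ : ℕ → PwConst T) (u : ℕ → PwAffine T),
      IsDiscreteSolution o μ lam a γ ε Δt M f ρ₀ ρ u ∧
        ∀ m, 1 ≤ m → m ≤ M → ∀ E, 0 < ρ m E := by
  have hN1 : 1 ≤ N := by omega
  choose R U hpos hmem hcont hmom using fun (m : ℕ) (r : {r : PwConst T // ∀ E, 0 < r E}) =>
    o.exists_step (ε := ε) hN1 hμ hμlam ha hγ hΔt (force Δt f m) r.2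
  let S : ℕ → {r : PwConst T // ∀ E, 0 < r E} := fun m =>
    Nat.rec ⟨ρ₀, hρ₀⟩ (fun k s => ⟨R (k + 1) s, hpos (k + 1) s⟩) m
  have hS : ∀ m, 1 ≤ m → (S m).1 = R m (S (m - 1)) := by
    intro m hm
    obtain ⟨k, rfl⟩ := Nat.exists_eq_add_of_le' hm
    rfl
  refine ⟨fun m => (S m).1, fun m => U m (S (m - 1)), ⟨rfl, fun m _ _ => hmem _ _,
    fun m hm _ => ?_, fun m hm _ => ?_⟩, fun m _ _ => (S m).2⟩
  · simp only [hS m hm]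
    exact hcont m (S (m - 1))
  · simp only [hS m hm]
    exact hmom m (S (m - 1))
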